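/- A \emph{reachability switching game} is a tuple $G=(V,E,V_R,V_S,V_{Swi},\mathrm{ord},s,t)$, where $(V,E)$ is a finite directed graph, $V_R,V_S,V_{Swi}$ partition $V$ into reachability, safety and switching vertices, $\mathrm{ord}$ assigns to each $v\in V_{Swi}$ a list containing each out-neighbour of $v$ exactly once, and $s,t\in V$ are the source and the target. A state is a pair $(v,C)$ with $v\in V$ and $C:V_{Swi}\to\mathbb N$. The game starts at $(s,0)$. At a state $(v,C)$ with $v\in V_R$ (resp. $v\in V_S$) the reachability (resp. safety) player chooses an edge $(v,u)\in E$, and the next state is $(u,C)$. At a state $(v,C)$ with $v\in V_{Swi}$ the next state is $(u,C')$, where $u$ is the element of $\mathrm{ord}(v)$ at position $C(v)$ (counting from $0$), $C'(v)=(C(v)+1)\bmod|\mathrm{ord}(v)|$, and $C'=C$ elsewhere. A play ends exactly when it reaches $t$ or a vertex without outgoing edges; it is won by the reachability player if it is finite and ends at $t$, and by the safety player otherwise (in particular if it is infinite). A strategy of a player is a function that maps every finite history ending at a vertex of that player with at least one outgoing edge to an outgoing edge of that vertex; it is winning if the player wins every play consistent with it. A player \emph{wins} $G$ if they have a winning strategy.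 \textbf{Theorem.} Deciding the winner of a (two-player) reachability switching game is in $\mathtt{EXPTIME}$. That is, with games on the vertex set $\{0,\dots,n-1\}$ encoded as binary words in a standard way (as adjacency lists, of length polynomial in $n$), both the language of the encodings of all games won by the reachability player and the language of the encodings of all games won by the safety player are decided by deterministic Turing machines which on each input word $w$ halt after at most $2^{p(|w|)}$ steps, for a polynomial $p$. -/

import Mathlib

/-- A language over `{0,1}` is in `EXPTIME` if some deterministic (multi-stack) Turing machine
decides it: on every input word `w` it halts, with output the single bit saying whether `w` is in
the language, after at most `2 ^ p(|w|)` steps, for a polynomial `p`. -/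
def InEXPTIME (L : Language Bool) : Prop :=
  ∃ (f : List Bool → Bool)
    (M : Turing.TM2ComputableInTime (id : List Bool → List Bool) Computability.encodeBool f)
    (p : Polynomial ℕ),
    (∀ w : List Bool, f w = true ↔ w ∈ L) ∧ ∀ n : ℕ, M.time n ≤ 2 ^ p.eval n

/-- The three kinds of vertices: reachability, safety and switching vertices. -/
inductive VertexKind : Type
  | reach
  | safety
  | switch
  deriving DecidableEq

/-- A reachability switching game on the vertex set `V`. The partition of the vertices is the map
`kind`; each switching vertex carries a list of its out-neighbours, each occurring once. -/
structure SwitchingGame (V : Type) where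
  /-- the directed edges -/
  E : Finset (V × V)
  /-- the partition into reachability, safety and switching vertices -/
  kind : V → VertexKind
  /-- the switching order -/
  ord : {v : V // kind v = VertexKind.switch} → List V
  ord_nodup : ∀ v, (ord v).Nodup
  mem_ord : ∀ v u, u ∈ ord v ↔ (v.1, u) ∈ E
  /-- the source -/
  s : V
  /-- the target -/
  t : V

namespace SwitchingGame

variable {V : Type} [DecidableEq V] (G : SwitchingGame V)

/-- The type of switching vertices. -/
abbrev Swi {V : Type} (G : SwitchingGame V) : Type := {v : V // G.kind v = VertexKind.switch}

/-- The states: a vertex together with a count for every switching vertex. (The counts occurring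
in plays start at `0` and are reduced modulo the length of the switching order.) -/
abbrev State {V : Type} (G : SwitchingGame V) : Type := V × (G.Swi → ℕ)

/-- The count function after a visit to the switching vertex `v`. -/
def upd (C : G.Swi → ℕ) (v : G.Swi) : G.Swi → ℕ :=
  fun u => if v = u then (C u + 1) % (G.ord u).length else C u

/-- The initial state. -/
def init {V : Type} (G : SwitchingGame V) : G.State := (G.s, fun _ => 0)

/-- The vertex `v` has an outgoing edge. -/
def HasOut {V : Type} (G : SwitchingGame V) (v : V) : Prop := ∃ u, (v, u) ∈ G.E

/-- The game moves from state `q` to state `q'`. At a vertex of a player the move goes along any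
edge and leaves the counts alone. At a switching vertex `v` it goes to the element at position
`C v` (counted from `0`) of the switching order, and the count of `v` advances. -/
def Step (q q' : G.State) : Prop :=
  (G.kind q.1 ≠ VertexKind.switch ∧ (q.1, q'.1) ∈ G.E ∧ q'.2 = q.2) ∨
    ∃ h : G.kind q.1 = VertexKind.switch,
      (G.ord ⟨q.1, h⟩)[q.2 ⟨q.1, h⟩]? = some q'.1 ∧ q'.2 = G.upd q.2 ⟨q.1, h⟩

/-- A finite or infinite play. It has the states `state i` for the natural numbers `i ≤ len`
(the values of `state` beyond `len` mean nothing). It stops exactly when it reaches the target or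
a vertex without outgoing edges. -/
structure Play where
  /-- the number of moves, possibly infinite -/
  len : ℕ∞
  /-- the sequence of states -/
  state : ℕ → G.State
  start : state 0 = G.init
  step : ∀ i : ℕ, (i : ℕ∞) < len → (state i).1 ≠ G.t ∧ G.Step (state i) (state (i + 1))
  ends : ∀ n : ℕ, len = n → (state n).1 = G.t ∨ ¬ G.HasOut (state n).1

namespace Play

variable {G}

/-- The prefix of a play ending with the state at time `i`. -/
def pre (π : G.Play) (i : ℕ) : List G.State := (List.range (i + 1)).map π.state

/-- The reachability player wins a play if it is finite and ends at the target. -/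
def ReachWins (π : G.Play) : Prop := ∃ n : ℕ, π.len = n ∧ (π.state n).1 = G.t

end Play

/-- A deterministic, history dependent strategy for the player who controls the vertices of kind
`k` (`reach` or `safety`): it maps each history that ends at such a vertex to (the endpoint of) an
outgoing edge of that vertex, if there is one. -/
structure Strategy {V : Type} (G : SwitchingGame V) (k : VertexKind) where
  /-- the vertex chosen after a history -/
  move : List G.State → V
  legal : ∀ (h : List G.State) (q : G.State),
    G.kind q.1 = k → G.HasOut q.1 → (q.1, move (h ++ [q])) ∈ G.E

/-- The play follows the strategy at all vertices of kind `k`. -/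
def Play.Consistent {G : SwitchingGame V} {k : VertexKind} (π : G.Play) (σ : G.Strategy k) : Prop :=
  ∀ i : ℕ, (i : ℕ∞) < π.len → G.kind (π.state i).1 = k →
    (π.state (i + 1)).1 = σ.move (π.pre i)

/-- The reachability player has a winning strategy. -/
def ReachPlayerWins : Prop :=
  ∃ σ : G.Strategy VertexKind.reach, ∀ π : G.Play, π.Consistent σ → π.ReachWins

/-- The safety player has a winning strategy. -/
def SafetyPlayerWins : Prop :=
  ∃ σ : G.Strategy VertexKind.safety, ∀ π : G.Play, π.Consistent σ → ¬ π.ReachWins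

/-! ### Games as input words -/

/-- The list of out-neighbours of a vertex: in switching order at a switching vertex, in increasing
order elsewhere. -/
def outList {n : ℕ} (G : SwitchingGame (Fin n)) (v : Fin n) : List (Fin n) :=
  if h : G.kind v = VertexKind.switch then G.ord ⟨v, h⟩
  else (List.finRange n).filter fun u => (v, u) ∈ G.E

/-- A number for each kind of vertex. -/
def kindCode : VertexKind → ℕ
  | VertexKind.reach => 0
  | VertexKind.safety => 1
  | VertexKind.switch => 2

/-- The game as a list of numbers: the number of vertices, the source, the target, and then for
each vertex its kind, its out-degree and its list of out-neighbours. -/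
def numbers {n : ℕ} (G : SwitchingGame (Fin n)) : List ℕ :=
  n :: (G.s : ℕ) :: (G.t : ℕ) ::
    (List.finRange n).flatMap fun v =>
      kindCode (G.kind v) :: (G.outList v).length :: (G.outList v).map Fin.val

/-- The input word of a game: each number `m` of the list is written as `m` ones followed by a
zero. All these numbers are at most `max n 2` and there are `3 + 2 n + |E|` of them, so that
the length of the word is polynomial in the number of vertices. -/
def encode {n : ℕ} (G : SwitchingGame (Fin n)) : List Bool :=
  G.numbers.flatMap fun m => List.replicate m true ++ [false]

/-- The language of the games that the reachability player wins. -/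
def reachLanguage : Language Bool :=
  {w | ∃ (n : ℕ) (G : SwitchingGame (Fin n)), G.encode = w ∧ G.ReachPlayerWins}

/-- The language of the games that the safety player wins. -/
def safetyLanguage : Language Bool :=
  {w | ∃ (n : ℕ) (G : SwitchingGame (Fin n)), G.encode = w ∧ G.SafetyPlayerWins}

end SwitchingGame

/-! A play of a switching game is a play of an ordinary reachability game on the graph of states. In
the states that matter, the counter of every switching vertex that has an outgoing edge lies below
its out-degree, and the other counters stay `0`. So there are at most exponentially many such states
in the length of the encoding, and solving a reachability game takes polynomial time in the number
of its states.

The reachability game is solved by backward induction. `Attr k` collects the states from which the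
target can be forced in fewer than `k` moves. If the initial state has a rank, moving so that the
least rank drops wins for the reachability player (`Attr.reachPlayerWins`). If it has none, the
safety player can stay among the states without a rank, because each state has finitely many
successors (`safetyPlayerWins_of_not_attr`). Two opposing strategies always have a common play
(`exists_consistent`), so the players cannot both win. Hence each winner is characterised by whether
the initial state has a rank, and the two languages are complementary among the encodings of games.

The algorithm lists all vectors of counts bounded by the out-degrees and iterates one attractor step
as often as there are states. Each round computes the next `Attr k` exactly
(`mem_iterate_iff_attr`), and an increasing chain of sublists is stationary by then
(`mem_iterate_filter_length`). Malformed words are rejected by parsing, checking validity and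
encoding again (`isGame_iff`).

For the Turing machine, structured stack programs are compiled with a step bound (`Runs.stepsTo`).
All data are binary trees written as prefix words. Programs compose, and a fold is cheap as long as
its accumulators stay small, so `PolyTime` is closed under the usual list operations. Only the
enumeration of the vectors is exponential (`size_allVectors_le`); everything else is polynomial in
the word and the enumerated list, hence exponential in the word alone (`expTime_decideWinner`). -/

/-! ### Structured programs on five binary stacks, and their compilation to Turing machines -/

namespace StackProgram

open Turing Function

/-- The names of the stacks. -/
inductive Reg : Type
  | M | A | B | C | D
  deriving DecidableEq

instance : Fintype Reg := ⟨{.M, .A, .B, .C, .D}, by rintro ⟨⟩ <;> decide⟩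

/-- The contents of the stacks. -/
abbrev Store : Type := Reg → List Bool

/-- Structured programs. `branch` pops a bit and continues accordingly (the last program is for the
empty stack). `drain` pops bits until the stack is empty, running a program for each bit.
`whileTrue` pops bits as long as they are `true`. -/
inductive Program : Type
  | skip
  | push (k : Reg) (b : Bool)
  | seq (p q : Program)
  | branch (k : Reg) (p q r : Program)
  | drain (k : Reg) (p q : Program)
  | whileTrue (k : Reg) (p : Program)

open Program

/-- The program leads from one store to another in at most the given number of steps. -/
inductive Runs : Program → Store → Store → ℕ → Prop
  | skip {S} : Runs skip S S 0
  | push {k b S} : Runs (push k b) S (update S k (b :: S k)) 1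
  | seq {p q S S₁ S₂ n m} : Runs p S S₁ n → Runs q S₁ S₂ m → Runs (seq p q) S S₂ (n + m)
  | branch_true {k p q r S S₁ l n} : S k = true :: l → Runs p (update S k l) S₁ n →
      Runs (branch k p q r) S S₁ (n + 1)
  | branch_false {k p q r S S₁ l n} : S k = false :: l → Runs q (update S k l) S₁ n →
      Runs (branch k p q r) S S₁ (n + 1)
  | branch_nil {k p q r S S₁ n} : S k = [] → Runs r S S₁ n → Runs (branch k p q r) S S₁ (n + 1)
  | drain_true {k p q S S₁ S₂ l n m} : S k = true :: l → Runs p (update S k l) S₁ n →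
      Runs (drain k p q) S₁ S₂ m → Runs (drain k p q) S S₂ (n + m + 1)
  | drain_false {k p q S S₁ S₂ l n m} : S k = false :: l → Runs q (update S k l) S₁ n →
      Runs (drain k p q) S₁ S₂ m → Runs (drain k p q) S S₂ (n + m + 1)
  | drain_nil {k p q S} : S k = [] → Runs (drain k p q) S S 1
  | while_true {k p S S₁ S₂ l n m} : S k = true :: l → Runs p (update S k l) S₁ n →
      Runs (whileTrue k p) S₁ S₂ m → Runs (whileTrue k p) S S₂ (n + m + 1)
  | while_false {k p S l} : S k = false :: l → Runs (whileTrue k p) S (update S k l) 1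
  | while_nil {k p S} : S k = [] → Runs (whileTrue k p) S S 1
  | weaken {p S S₁ n m} : Runs p S S₁ n → n ≤ m → Runs p S S₁ m

/-- The labels needed for a program. -/
def Lab : Program → Type
  | skip => Empty
  | push _ _ => Unit
  | seq p q => Lab p ⊕ Lab q
  | branch _ p q r => Option (Lab p ⊕ Lab q ⊕ Lab r)
  | drain _ p q => Option (Lab p ⊕ Lab q)
  | whileTrue _ p => Option (Lab p)

noncomputable instance Lab.fintype : ∀ p, Fintype (Lab p)
  | skip => inferInstanceAs (Fintype Empty)
  | push _ _ => inferInstanceAs (Fintype Unit)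
  | seq p q =>
    letI := Lab.fintype p
    letI := Lab.fintype q
    inferInstanceAs (Fintype (Lab p ⊕ Lab q))
  | branch _ p q r =>
    letI := Lab.fintype p
    letI := Lab.fintype q
    letI := Lab.fintype r
    inferInstanceAs (Fintype (Option (Lab p ⊕ Lab q ⊕ Lab r)))
  | drain _ p q =>
    letI := Lab.fintype p
    letI := Lab.fintype q
    inferInstanceAs (Fintype (Option (Lab p ⊕ Lab q)))
  | whileTrue _ p =>
    letI := Lab.fintype p
    inferInstanceAs (Fintype (Option (Lab p)))

/-- The label at which a program starts, for an embedding `e` of its labels and an exit `x`. -/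
def entry {Λ : Type} : (p : Program) → (Lab p → Λ) → Λ → Λ
  | skip, _, x => x
  | push _ _, e, _ => e ()
  | seq p q, e, x => entry p (fun l => e (.inl l)) (entry q (fun l => e (.inr l)) x)
  | branch _ _ _ _, e, _ => e none
  | drain _ _ _, e, _ => e none
  | whileTrue _ _, e, _ => e none

/-- Pop a bit and jump accordingly. -/
def popJump {Λ : Type} (k : Reg) (a b c : Λ) : TM2.Stmt (fun _ : Reg => Bool) Λ (Option Bool) :=
  .pop k (fun _ o => o) <|
    .branch (fun v => v == some true) (.load (fun _ => none) (.goto fun _ => a)) <|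
      .branch (fun v => v == some false) (.load (fun _ => none) (.goto fun _ => b))
        (.load (fun _ => none) (.goto fun _ => c))

/-- The machine code of a program. -/
def code {Λ : Type} : (p : Program) → (Lab p → Λ) → Λ → Lab p →
    TM2.Stmt (fun _ : Reg => Bool) Λ (Option Bool)
  | skip, _, _, l => nomatch l
  | push k b, _, x, _ => .push k (fun _ => b) (.goto fun _ => x)
  | seq p q, e, x, .inl l => code p (fun l => e (.inl l)) (entry q (fun l => e (.inr l)) x) l
  | seq _ q, e, x, .inr l => code q (fun l => e (.inr l)) x l
  | branch k p q r, e, x, none => popJump k (entry p (fun l => e (some (.inl l))) x)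
      (entry q (fun l => e (some (.inr (.inl l)))) x)
      (entry r (fun l => e (some (.inr (.inr l)))) x)
  | branch _ p _ _, e, x, some (.inl l) => code p (fun l => e (some (.inl l))) x l
  | branch _ _ q _, e, x, some (.inr (.inl l)) => code q (fun l => e (some (.inr (.inl l)))) x l
  | branch _ _ _ r, e, x, some (.inr (.inr l)) => code r (fun l => e (some (.inr (.inr l)))) x l
  | drain k p q, e, x, none => popJump k (entry p (fun l => e (some (.inl l))) (e none))
      (entry q (fun l => e (some (.inr l))) (e none)) x
  | drain _ p _, e, _, some (.inl l) => code p (fun l => e (some (.inl l))) (e none) l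
  | drain _ _ q, e, _, some (.inr l) => code q (fun l => e (some (.inr l))) (e none) l
  | whileTrue k p, e, x, none => popJump k (entry p (fun l => e (some l)) (e none)) x x
  | whileTrue _ p, e, _, some l => code p (fun l => e (some l)) (e none) l

/-! ### Correctness of the compilation -/

section Simulation

variable {Λ : Type} (m : Λ → TM2.Stmt (fun _ : Reg => Bool) Λ (Option Bool))

/-- The machine gets from a label and store to another label and store in at most `n` steps. -/
def StepsTo (a : Λ) (S : Store) (b : Λ) (S' : Store) (n : ℕ) : Prop :=
  ∃ j ≤ n, (flip bind (TM2.step m))^[j] (some ⟨some a, none, S⟩) = some ⟨some b, none, S'⟩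

variable {m}

theorem StepsTo.refl {a : Λ} {S : Store} : StepsTo m a S a S 0 := ⟨0, le_rfl, rfl⟩

theorem StepsTo.mono {a b : Λ} {S S' : Store} {n n' : ℕ} (h : StepsTo m a S b S' n) (hn : n ≤ n') :
    StepsTo m a S b S' n' := by
  obtain ⟨j, hj, h⟩ := h
  exact ⟨j, hj.trans hn, h⟩

theorem StepsTo.trans {a b c : Λ} {S S' S'' : Store} {n n' : ℕ} (h : StepsTo m a S b S' n)
    (h' : StepsTo m b S' c S'' n') : StepsTo m a S c S'' (n + n') := by
  obtain ⟨j, hj, h⟩ := h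
  obtain ⟨j', hj', h'⟩ := h'
  refine ⟨j' + j, by omega, ?_⟩
  rw [iterate_add_apply, h, h']

theorem StepsTo.single {a b : Λ} {S S' : Store}
    (h : TM2.step m ⟨some a, none, S⟩ = some ⟨some b, none, S'⟩) : StepsTo m a S b S' 1 :=
  ⟨1, le_rfl, by simpa [flip] using h⟩

theorem StepsTo.pop_true {a x y z : Λ} {k : Reg} {S : Store} {l : List Bool}
    (h : m a = popJump k x y z) (hS : S k = true :: l) : StepsTo m a S x (update S k l) 1 :=
  .single (by simp [h, popJump, hS])

theorem StepsTo.pop_false {a x y z : Λ} {k : Reg} {S : Store} {l : List Bool}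
    (h : m a = popJump k x y z) (hS : S k = false :: l) : StepsTo m a S y (update S k l) 1 :=
  .single (by simp [h, popJump, hS])

theorem StepsTo.pop_nil {a x y z : Λ} {k : Reg} {S : Store}
    (h : m a = popJump k x y z) (hS : S k = []) : StepsTo m a S z S 1 := by
  have hu : update S k [] = S := by rw [← hS, update_eq_self]
  exact .single (by simp [h, popJump, hS, hu])

/-- Induction on the derivation. The embedding of labels and the exit are arbitrary, so that the
hypothesis applies to a subprogram sitting inside a larger one: the exit of a first component is the
entry of the second, and the exit of a loop body is the loop head. -/
theorem Runs.stepsTo {p : Program} {S S' : Store} {n : ℕ} (h : Runs p S S' n) :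
    ∀ (e : Lab p → Λ) (x : Λ), (∀ l, m (e l) = code p e x l) →
      StepsTo m (entry p e x) S x S' n := by
  induction h with
  | skip => exact fun e x _ => .refl
  | push =>
    intro e x hm
    exact .single (congrArg (fun q => some (TM2.stepAux q none _)) (hm ()))
  | seq _ _ ih₁ ih₂ =>
    intro e x hm
    exact (ih₁ _ _ fun l => hm (.inl l)).trans (ih₂ _ _ fun l => hm (.inr l))
  | branch_true hS _ ih =>
    intro e x hm
    exact ((StepsTo.pop_true (hm none) hS).trans (ih _ _ fun l => hm (some (.inl l)))).mono
      (by omega)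
  | branch_false hS _ ih =>
    intro e x hm
    exact ((StepsTo.pop_false (hm none) hS).trans (ih _ _ fun l => hm (some (.inr (.inl l))))).mono
      (by omega)
  | branch_nil hS _ ih =>
    intro e x hm
    exact ((StepsTo.pop_nil (hm none) hS).trans (ih _ _ fun l => hm (some (.inr (.inr l))))).mono
      (by omega)
  | drain_true hS _ _ ih₁ ih₂ =>
    intro e x hm
    exact (((StepsTo.pop_true (hm none) hS).trans (ih₁ _ _ fun l => hm (some (.inl l)))).trans
      (ih₂ _ _ hm)).mono (by omega)
  | drain_false hS _ _ ih₁ ih₂ =>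
    intro e x hm
    exact (((StepsTo.pop_false (hm none) hS).trans (ih₁ _ _ fun l => hm (some (.inr l)))).trans
      (ih₂ _ _ hm)).mono (by omega)
  | drain_nil hS =>
    intro e x hm
    exact StepsTo.pop_nil (hm none) hS
  | while_true hS _ _ ih₁ ih₂ =>
    intro e x hm
    exact (((StepsTo.pop_true (hm none) hS).trans (ih₁ _ _ fun l => hm (some l))).trans
      (ih₂ _ _ hm)).mono (by omega)
  | while_false hS =>
    intro e x hm
    exact StepsTo.pop_false (hm none) hS
  | while_nil hS =>
    intro e x hm
    exact StepsTo.pop_nil (hm none) hS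
  | weaken _ hn ih => exact fun e x hm => (ih e x hm).mono hn

end Simulation

/-- The Turing machine that runs a program and halts. -/
noncomputable def machine (p : Program) : FinTM2 where
  K := Reg
  k₀ := .M
  k₁ := .M
  Γ _ := Bool
  Λ := Option (Lab p)
  main := entry p some none
  σ := Option Bool
  initialState := none
  Γk₀Fin := inferInstanceAs (Fintype Bool)
  m
    | none => .halt
    | some l => code p some none l

/-- The store with the given contents. -/
def store (m a b c d : List Bool) : Store
  | .M => m
  | .A => a
  | .B => b
  | .C => c
  | .D => d

/-- A program that computes a function on words yields a Turing machine for it. -/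
noncomputable def computableInTime (p : Program) (f : List Bool → Bool) (time : ℕ → ℕ)
    (h : ∀ w, Runs p (store w [] [] [] []) (store [f w] [] [] [] []) (time w.length)) :
    TM2ComputableInTime (id : List Bool → List Bool) Computability.encodeBool f where
  tm := machine p
  inputAlphabet := Equiv.refl Bool
  outputAlphabet := Equiv.refl Bool
  time n := time n + 1
  outputsFun w := Nonempty.some <| by
    obtain ⟨j, hj, hs⟩ := (h w).stepsTo (m := (machine p).m) some none fun _ => rfl
    have h₀ : initList (machine p) (List.map (Equiv.refl Bool).invFun (id w)) =
        ⟨some (entry p some none), none, store w [] [] [] []⟩ := by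
      unfold initList
      congr 1
      funext k
      cases k <;> (simp [machine, store]; try rfl)
    have h₁ : haltList (machine p)
        (List.map (Equiv.refl Bool).invFun (Computability.encodeBool (f w))) =
        ⟨none, none, store [f w] [] [] [] []⟩ := by
      unfold haltList
      congr 1
      funext k
      cases k <;> (simp [machine, store, Computability.encodeBool]; try rfl)
    -- One more step executes the halt statement at the exit label `none`.
    refine ⟨⟨⟨j + 1, ?_⟩, by simpa using hj⟩⟩
    rw [add_comm, iterate_add_apply, Option.map_some]
    erw [h₀, hs, h₁]
    rfl

end StackProgram

namespace StackProgram

open Turing Function Program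

/-! ### Binary trees on the stacks -/

/-- Binary trees, the universal data type of the programs. -/
inductive BinTree : Type
  | leaf
  | node (a b : BinTree)

namespace BinTree

/-- The word of a tree, in prefix order. -/
def word : BinTree → List Bool
  | leaf => [false]
  | node a b => true :: (a.word ++ b.word)

/-- The number of vertices of a tree. -/
def size : BinTree → ℕ
  | leaf => 1
  | node a b => a.size + b.size + 1

@[simp] theorem length_word (t : BinTree) : t.word.length = t.size := by
  induction t with
  | leaf => rfl
  | node a b iha ihb => simp [word, size, iha, ihb]

theorem one_le_size (t : BinTree) : 1 ≤ t.size := by cases t <;> simp [size]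

/-- Prefix words of trees form a prefix code: a tree on top of a stack is delimited without any end
marker. -/
theorem word_append_inj {s t : BinTree} {u v : List Bool} (h : s.word ++ u = t.word ++ v) :
    s = t ∧ u = v := by
  induction s generalizing t u v with
  | leaf => cases t <;> simp_all [word]
  | node a b iha ihb =>
    cases t with
    | leaf => simp [word] at h
    | node a' b' =>
      simp only [word, List.cons_append, List.append_assoc, List.cons.injEq, true_and] at h
      obtain ⟨rfl, h'⟩ := iha h
      obtain ⟨rfl, h''⟩ := ihb h'
      exact ⟨rfl, h''⟩

theorem word_injective : Injective word := fun s t h =>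
  (word_append_inj (u := []) (v := []) (by simpa using h)).1

end BinTree

open BinTree

infixr:60 " ⨾ " => Program.seq

section Store

variable (m a b c d x : List Bool)

@[simp] theorem store_M : store m a b c d .M = m := rfl
@[simp] theorem store_A : store m a b c d .A = a := rfl
@[simp] theorem store_B : store m a b c d .B = b := rfl
@[simp] theorem store_C : store m a b c d .C = c := rfl
@[simp] theorem store_D : store m a b c d .D = d := rfl

@[simp] theorem update_store_M : update (store m a b c d) .M x = store x a b c d := by
  funext k; cases k <;> rfl
@[simp] theorem update_store_A : update (store m a b c d) .A x = store m x b c d := by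
  funext k; cases k <;> rfl
@[simp] theorem update_store_B : update (store m a b c d) .B x = store m a x c d := by
  funext k; cases k <;> rfl
@[simp] theorem update_store_C : update (store m a b c d) .C x = store m a b x d := by
  funext k; cases k <;> rfl
@[simp] theorem update_store_D : update (store m a b c d) .D x = store m a b c x := by
  funext k; cases k <;> rfl

end Store

theorem Runs.congr {p : Program} {S S₁ S₂ : Store} {n : ℕ} (h : Runs p S S₁ n) (e : S₁ = S₂) :
    Runs p S S₂ n := e ▸ h

/-- Move the bits of a stack to another one. -/
def pour (k j : Reg) : Program := drain k (push j true) (push j false)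

theorem runs_pour {k j : Reg} (hk : k ≠ j) (l : List Bool) : ∀ S : Store, S k = l →
    Runs (pour k j) S (update (update S j (l.reverse ++ S j)) k []) (2 * l.length + 1) := by
  induction l with
  | nil =>
    intro S h
    refine (Runs.drain_nil h).congr ?_
    rw [List.reverse_nil, List.nil_append, update_eq_self, ← h, update_eq_self]
  | cons b l ih =>
    intro S h
    have hpush : ∀ b, Runs (push j b) (update S k l) (update (update S k l) j (b :: S j)) 1 :=
      fun b => Runs.push.congr (by simp [hk.symm])
    have hrest : ∀ b, Runs (pour k j) (update (update S k l) j (b :: S j))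
        (update (update S j ((b :: l).reverse ++ S j)) k []) (2 * l.length + 1) := fun b =>
      (ih (update (update S k l) j (b :: S j)) (by simp [hk])).congr (by
        funext r
        simp only [update_apply]
        split_ifs <;> simp_all)
    cases b
    · exact (Runs.drain_false h (hpush _) (hrest _)).weaken (by simp; omega)
    · exact (Runs.drain_true h (hpush _) (hrest _)).weaken (by simp; omega)

/-- Empty a stack. -/
def clear (k : Reg) : Program := drain k skip skip

theorem runs_clear {k : Reg} (l : List Bool) : ∀ S : Store, S k = l →
    Runs (clear k) S (update S k []) (l.length + 1) := by
  induction l with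
  | nil => exact fun S h => (Runs.drain_nil h).congr (by simp [← h])
  | cons b l ih =>
    intro S h
    have := (ih (update S k l) (by simp)).congr (update_idem _ _ _)
    cases b
    · exact (Runs.drain_false h .skip this).weaken (by simp)
    · exact (Runs.drain_true h .skip this).weaken (by simp)

/-- Move one bit of the main stack to another stack, counting outstanding trees on stack `D`. -/
def moveBit (k : Reg) : Program :=
  branch .M (push k true ⨾ push .D true ⨾ push .D true) (push k false) skip

/-- Move a tree from the main stack to another stack, reversing its word. -/
def move (k : Reg) : Program := push .D true ⨾ whileTrue .D (moveBit k)

/-- Stack `D` holds one bit for each tree still to be read; a leaf consumes one, a node consumes one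
and adds two. The rest of the run is a hypothesis, so that the runs for the two subtrees chain
inside one and the same loop. -/
theorem runs_move_aux {k : Reg} (hM : k ≠ .M) (hD : k ≠ .D) (t : BinTree) :
    ∀ (S : Store) (m d : List Bool) (S' : Store) (n : ℕ), S .M = t.word ++ m → S .D = true :: d →
      Runs (whileTrue .D (moveBit k))
        (update (update (update S .M m) .D d) k (t.word.reverse ++ S k)) S' n →
      Runs (whileTrue .D (moveBit k)) S S' (n + 5 * t.size) := by
  have hMD : Reg.M ≠ .D := by decide
  induction t with
  | leaf =>
    intro S m d S' n h₁ h₂ h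
    have h₃ : Runs (moveBit k) (update S .D d) _ 2 :=
      Runs.branch_false (l := m) (by simp [h₁, word]) .push
    refine (Runs.while_true h₂ h₃ ?_).weaken (n := 2 + n + 1) (by simp [size]; omega)
    convert h using 1
    funext r
    simp only [update_apply]
    split_ifs <;> simp_all [word]
  | node a b iha ihb =>
    intro S m d S' n h₁ h₂ h
    have h₃ : Runs (moveBit k) (update S .D d) (update (update (update S .M (a.word ++ (b.word ++ m)))
        .D (true :: true :: d)) k (true :: S k)) 4 := by
      refine Runs.branch_true (l := a.word ++ (b.word ++ m)) (by simp [h₁, word])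
        ((Runs.push.seq (Runs.push.seq .push)).congr ?_)
      funext r
      simp only [update_apply]
      split_ifs <;> simp_all
    refine (Runs.while_true h₂ h₃ (iha _ (b.word ++ m) (true :: d) _ _ (by simp [hM.symm])
      (by simp [hD.symm]) (ihb _ m d S' n (by simp [hM.symm]) (by simp [hD.symm]) ?_))).weaken
      (by simp [size]; omega)
    convert h using 1
    funext r
    simp only [update_apply]
    split_ifs <;> simp_all [word]

theorem runs_move {k : Reg} (hM : k ≠ .M) (hD : k ≠ .D) (t : BinTree) {S : Store} {m : List Bool}
    (h₁ : S .M = t.word ++ m) (h₂ : S .D = []) :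
    Runs (move k) S (update (update S .M m) k (t.word.reverse ++ S k)) (5 * t.size + 2) := by
  refine (Runs.push.seq (runs_move_aux hM hD t _ m [] _ 1 (by simp [h₁]) (by simp [h₂])
    ((Runs.while_nil ?_).congr ?_))).weaken (by omega)
  · simp [hD.symm]
  · funext r
    simp only [update_apply]
    split_ifs <;> simp_all

variable {s t u : BinTree} {m a b c : List Bool}

theorem runs_moveA : Runs (move .A) (store (t.word ++ m) [] b c [])
    (store m t.word.reverse b c []) (5 * t.size + 2) :=
  (runs_move (by decide) (by decide) t rfl rfl).congr (by simp)

theorem runs_moveB : Runs (move .B) (store (t.word ++ m) a [] c [])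
    (store m a t.word.reverse c []) (5 * t.size + 2) :=
  (runs_move (by decide) (by decide) t rfl rfl).congr (by simp)

theorem runs_moveC : Runs (move .C) (store (t.word ++ m) a b [] [])
    (store m a b t.word.reverse []) (5 * t.size + 2) :=
  (runs_move (by decide) (by decide) t rfl rfl).congr (by simp)

theorem runs_pourA : Runs (pour .A .M) (store m t.word.reverse b c [])
    (store (t.word ++ m) [] b c []) (2 * t.size + 1) :=
  ((runs_pour (by decide) _ _ rfl).congr (by simp)).weaken (by simp)

theorem runs_pourB : Runs (pour .B .M) (store m a t.word.reverse c [])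
    (store (t.word ++ m) a [] c []) (2 * t.size + 1) :=
  ((runs_pour (by decide) _ _ rfl).congr (by simp)).weaken (by simp)

theorem runs_pourC : Runs (pour .C .M) (store m a b t.word.reverse [])
    (store (t.word ++ m) a b [] []) (2 * t.size + 1) :=
  ((runs_pour (by decide) _ _ rfl).congr (by simp)).weaken (by simp)

/-! ### Operations on the trees on top of the main stack -/

/-- The store with the given contents of the main stack and all other stacks empty. -/
abbrev base (m : List Bool) : Store := store m [] [] [] []

/-- Remove the first tree. -/
def drop : Program := move .A ⨾ clear .A

theorem runs_drop : Runs drop (base (t.word ++ m)) (base m) (6 * t.size + 3) :=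
  (runs_moveA.seq ((runs_clear _ _ rfl).congr (by simp))).weaken (by simp; omega)

/-- Exchange the first two trees. -/
def swap : Program := move .A ⨾ move .B ⨾ pour .A .M ⨾ pour .B .M

theorem runs_swap : Runs swap (base (s.word ++ (t.word ++ m))) (base (t.word ++ (s.word ++ m)))
    (7 * s.size + 7 * t.size + 6) :=
  (runs_moveA.seq (runs_moveB.seq (runs_pourA.seq runs_pourB))).weaken (by omega)

/-- Copy the bits of stack `A` to the main stack and stack `B`. -/
def copyBits : Program := drain .A (push .M true ⨾ push .B true) (push .M false ⨾ push .B false)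

theorem runs_copyBits (a : List Bool) : ∀ m b, Runs copyBits (store m a b c [])
    (store (a.reverse ++ m) [] (a.reverse ++ b) c []) (3 * a.length + 1) := by
  induction a with
  | nil => exact fun m b => Runs.drain_nil rfl
  | cons x a ih =>
    intro m b
    cases x
    · exact ((Runs.drain_false (l := a) rfl ((Runs.push.seq .push).congr (by simp; rfl))
        (ih _ _)).congr (by simp)).weaken (by simp; omega)
    · exact ((Runs.drain_true (l := a) rfl ((Runs.push.seq .push).congr (by simp; rfl))
        (ih _ _)).congr (by simp)).weaken (by simp; omega)

/-- Duplicate the first tree. -/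
def dup : Program := move .A ⨾ copyBits ⨾ pour .B .A ⨾ pour .A .M

theorem runs_dup : Runs dup (base (t.word ++ m)) (base (t.word ++ (t.word ++ m)))
    (12 * t.size + 5) := by
  refine (runs_moveA.seq ((runs_copyBits _ _ _).seq ((runs_pour (by decide) _ _ rfl).seq
    (Runs.congr (n := 2 * t.size + 1) ?_ rfl)))).weaken (by simp; omega)
  simpa using runs_pourA

/-- Move the second tree below the third one. -/
def under : Program := move .A ⨾ move .B ⨾ move .C ⨾ pour .B .M ⨾ pour .C .M ⨾ pour .A .M

theorem runs_under : Runs under (base (s.word ++ (t.word ++ (u.word ++ m))))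
    (base (s.word ++ (u.word ++ (t.word ++ m)))) (7 * s.size + 7 * t.size + 7 * u.size + 9) :=
  (runs_moveA.seq (runs_moveB.seq (runs_moveC.seq (runs_pourB.seq (runs_pourC.seq
    runs_pourA))))).weaken (by omega)

/-- Replace a tree by its left part. -/
def left : Program := branch .M (move .A ⨾ move .B ⨾ clear .B ⨾ pour .A .M) (push .M false) skip

/-- Replace a tree by its right part. -/
def right : Program := branch .M drop (push .M false) skip

theorem runs_left_node : Runs left (base ((node s t).word ++ m)) (base (s.word ++ m))
    (7 * s.size + 6 * t.size + 7) := by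
  refine (Runs.branch_true (l := s.word ++ (t.word ++ m)) (by simp [word]) ?_).weaken
    (n := (5 * s.size + 2) + ((5 * t.size + 2) + ((t.size + 1) + (2 * s.size + 1))) + 1) (by omega)
  rw [update_store_M]
  exact runs_moveA.seq (runs_moveB.seq ((((runs_clear _ _ rfl).congr
    (update_store_B _ _ _ _ _ _)).weaken (by simp)).seq runs_pourA))

theorem runs_right_node : Runs right (base ((node s t).word ++ m)) (base (t.word ++ m))
    (6 * s.size + 4) := by
  refine Runs.branch_true (l := s.word ++ (t.word ++ m)) (by simp [word]) ?_
  rw [update_store_M]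
  exact runs_drop

/-- Push a word onto the main stack. -/
def pushWord : List Bool → Program
  | [] => skip
  | b :: l => pushWord l ⨾ push .M b

theorem runs_pushWord (l : List Bool) : Runs (pushWord l) (base m) (base (l ++ m)) l.length := by
  induction l with
  | nil => exact .skip
  | cons b l ih => exact (ih.seq .push).congr (by simp)

/-- Compare the contents of the stacks `A` and `B`, leaving a trace on stack `D` if they differ. -/
def compareBits : Program :=
  drain .A (branch .B skip (push .D true) (push .D true))
    (branch .B (push .D true) skip (push .D true))

/-- A mismatch, or `B` running out first, leaves a bit on `D`; if `B` is longer, its surplus stays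
on `B`. Equality is thus the emptiness of both. The length bounds serve the cost of cleaning up. -/
theorem runs_compareBits (a : List Bool) : ∀ b d : List Bool, ∃ b' d' : List Bool,
    Runs compareBits (store m a b c d) (store m [] b' c d') (3 * a.length + 1) ∧
      b'.length ≤ b.length ∧ d'.length ≤ d.length + a.length ∧
      (b' = [] ∧ d' = [] ↔ a = b ∧ d = []) := by
  induction a with
  | nil => exact fun b d => ⟨b, d, .drain_nil rfl, le_rfl, le_rfl, by simp [eq_comm]⟩
  | cons x a ih =>
    intro b d
    rcases b with _ | ⟨y, b⟩
    · obtain ⟨b', d', h, h₁, h₂, h₃⟩ := ih [] (true :: d)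
      refine ⟨b', d', ?_, h₁, by simp at h₂ ⊢; omega, by simp [h₃]⟩
      cases x
      · exact (Runs.drain_false (l := a) rfl ((Runs.branch_nil rfl .push).congr (by simp))
          h).weaken (by simp; omega)
      · exact (Runs.drain_true (l := a) rfl ((Runs.branch_nil rfl .push).congr (by simp))
          h).weaken (by simp; omega)
    · obtain ⟨b', d', h, h₁, h₂, h₃⟩ := ih b (if x = y then d else true :: d)
      refine ⟨b', d', ?_, h₁.trans (by simp), h₂.trans ?_, by rw [h₃]; cases x <;> cases y <;> simp⟩
      · cases x <;> cases y
        · exact (Runs.drain_false (l := a) rfl ((Runs.branch_false (l := b) rfl .skip).congr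
            (by simp)) h).weaken (by simp; omega)
        · exact (Runs.drain_false (l := a) rfl ((Runs.branch_true (l := b) rfl .push).congr
            (by simp)) h).weaken (by simp; omega)
        · exact (Runs.drain_true (l := a) rfl ((Runs.branch_false (l := b) rfl .push).congr
            (by simp)) h).weaken (by simp; omega)
        · exact (Runs.drain_true (l := a) rfl ((Runs.branch_true (l := b) rfl .skip).congr
            (by simp)) h).weaken (by simp; omega)
      · split_ifs <;> (simp; try omega)

/-- The tree of a truth value. -/
def boolTree : Bool → BinTree
  | false => leaf
  | true => node leaf leaf

/-- Replace a pair by the truth value of the equality of its parts. -/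
def equal : Program :=
  branch .M (move .A ⨾ move .B ⨾ compareBits ⨾ drain .B (push .D true) (push .D true) ⨾
    branch .D (clear .D ⨾ pushWord (boolTree false).word)
      (clear .D ⨾ pushWord (boolTree false).word) (pushWord (boolTree true).word)) skip skip

theorem runs_trace (b : List Bool) : ∀ d : List Bool, ∃ d' : List Bool,
    Runs (drain .B (push .D true) (push .D true)) (store m a b c d) (store m a [] c d')
      (2 * b.length + 1) ∧ d'.length = d.length + b.length := by
  induction b with
  | nil => exact fun d => ⟨d, .drain_nil rfl, rfl⟩
  | cons x b ih =>
    intro d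
    obtain ⟨d', h, h₁⟩ := ih (true :: d)
    refine ⟨d', ?_, by simp [h₁]; omega⟩
    cases x
    · exact (Runs.drain_false (l := b) rfl (Runs.push.congr (by simp)) h).weaken (by simp; omega)
    · exact (Runs.drain_true (l := b) rfl (Runs.push.congr (by simp)) h).weaken (by simp; omega)

/-- The surplus of `B` is turned into further bits on `D`, so that a single test of `D` decides.
Equality of words is equality of trees by `word_injective`. -/
theorem runs_equal {r : Bool} (hr : r = true ↔ s = t) : Runs equal (base ((node s t).word ++ m))
    (base ((boolTree r).word ++ m)) (10 * s.size + 10 * t.size + 20) := by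
  obtain ⟨b', d₁, h₁, hb, hd₁, e₁⟩ := runs_compareBits (m := m) (c := []) s.word.reverse
    t.word.reverse []
  obtain ⟨d, h₂, hd⟩ := runs_trace (m := m) (a := []) (c := []) b' d₁
  have e : d = [] ↔ s = t := by
    rw [← List.length_eq_zero_iff, hd, Nat.add_eq_zero_iff, List.length_eq_zero_iff,
      List.length_eq_zero_iff, and_comm, e₁]
    simp [BinTree.word_injective.eq_iff]
  simp only [List.length_reverse, length_word, List.length_nil] at hb hd₁ h₁
  suffices h : Runs (branch .D (clear .D ⨾ pushWord (boolTree false).word)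
      (clear .D ⨾ pushWord (boolTree false).word) (pushWord (boolTree true).word))
      (store m [] [] [] d) (base ((boolTree r).word ++ m))
      (s.size + t.size + 5) by
    refine (Runs.branch_true (l := s.word ++ (t.word ++ m)) (by simp [word]) ?_).weaken
      (n := (5 * s.size + 2) + ((5 * t.size + 2) + ((3 * s.size + 1) + ((2 * t.size + 1) +
        (s.size + t.size + 5)))) + 1) (by omega)
    rw [update_store_M]
    exact runs_moveA.seq (runs_moveB.seq (h₁.seq ((h₂.weaken (by omega)).seq h)))
  rcases d with _ | ⟨x, d⟩
  · obtain rfl := hr.2 (e.1 rfl)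
    exact (Runs.branch_nil rfl (runs_pushWord _)).weaken (by simp [boolTree, size])
  · obtain rfl : r = false := by
      rw [← Bool.not_eq_true, hr, ← e]
      simp
    have h₃ : Runs (clear .D ⨾ pushWord (boolTree false).word) (store m [] [] [] d)
        (base ((boolTree false).word ++ m)) (s.size + t.size + 4) :=
      (((runs_clear d (store m [] [] [] d) rfl).congr (update_store_D _ _ _ _ _ _)).seq
        (runs_pushWord _)).weaken (by simp [boolTree, size] at hd ⊢; omega)
    cases x
    · exact Runs.branch_false rfl (by rwa [update_store_D])
    · exact Runs.branch_true rfl (by rwa [update_store_D])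

end StackProgram

namespace StackProgram

open Turing Function Program BinTree

/-! ### Encoded types and computable functions between them -/

/-- Types whose elements are represented by binary trees. -/
class Enc (α : Type) where
  /-- the tree of an element -/
  enc : α → BinTree
  inj : Injective enc

open Enc

/-- The number of vertices of the tree of an element. -/
def size {α : Type} [Enc α] (x : α) : ℕ := (enc x).size

/-- The tree of a natural number. -/
def natTree : ℕ → BinTree
  | 0 => leaf
  | n + 1 => node leaf (natTree n)

/-- The tree of a list. -/
def listTree {α : Type} [Enc α] : List α → BinTree
  | [] => leaf
  | a :: l => node (enc a) (listTree l)

instance : Enc Unit := ⟨fun _ => leaf, fun _ _ _ => rfl⟩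

instance : Enc Bool := ⟨boolTree, by intro a b; cases a <;> cases b <;> simp [boolTree]⟩

instance : Enc ℕ := ⟨natTree, by
  intro a
  induction a with
  | zero => intro b; cases b <;> simp [natTree]
  | succ a ih =>
    intro b
    cases b with
    | zero => simp [natTree]
    | succ b => simpa [natTree] using @ih b⟩

instance {α β : Type} [Enc α] [Enc β] : Enc (α × β) := ⟨fun p => node (enc p.1) (enc p.2), by
  rintro ⟨a, b⟩ ⟨c, d⟩ h
  simp only [node.injEq] at h
  rw [inj h.1, inj h.2]⟩

instance {α : Type} [Enc α] : Enc (List α) := ⟨listTree, by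
  intro a
  induction a with
  | nil => intro b; cases b <;> simp [listTree]
  | cons x a ih =>
    intro b
    cases b with
    | nil => simp [listTree]
    | cons y b =>
      intro h
      simp only [listTree, node.injEq] at h
      rw [inj h.1, ih h.2]⟩

variable {α β γ δ : Type} [Enc α] [Enc β] [Enc γ] [Enc δ]

theorem enc_pair (a : α) (b : β) : enc (a, b) = node (enc a) (enc b) := rfl
theorem enc_nil : enc ([] : List α) = leaf := rfl
theorem enc_cons (a : α) (l : List α) : enc (a :: l) = node (enc a) (enc l) := rfl
theorem enc_true : enc true = node leaf leaf := rfl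
theorem enc_false : enc false = leaf := rfl

theorem one_le_size (x : α) : 1 ≤ size x := BinTree.one_le_size _

@[simp] theorem size_pair (a : α) (b : β) : size (a, b) = size a + size b + 1 := rfl
@[simp] theorem size_nil : size ([] : List α) = 1 := rfl
@[simp] theorem size_cons (a : α) (l : List α) : size (a :: l) = size a + size l + 1 := rfl
theorem size_bool_le (b : Bool) : size b ≤ 3 := by cases b <;> decide
@[simp] theorem size_nat (n : ℕ) : size n = 2 * n + 1 := by
  induction n with
  | zero => rfl
  | succ n ih =>
    change 1 + size n + 1 = _
    omega

theorem length_le_size (l : List α) : l.length ≤ size l := by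
  induction l with
  | nil => simp
  | cons a l ih => simp; omega

theorem size_append (l₁ l₂ : List α) : size (l₁ ++ l₂) + 1 = size l₁ + size l₂ := by
  induction l₁ with
  | nil => simp; omega
  | cons a l ih => simp; omega

theorem size_le_of_mem {a : α} {l : List α} (h : a ∈ l) : size a ≤ size l := by
  induction l with
  | nil => simp at h
  | cons b l ih =>
    rcases List.mem_cons.1 h with rfl | h
    · simp; omega
    · have := ih h
      simp; omega

theorem size_prefix {l₁ l : List α} (h : l₁ <+: l) : size l₁ ≤ size l := by
  obtain ⟨l₂, rfl⟩ := h
  have := size_append l₁ l₂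
  have := one_le_size l₂
  omega

theorem size_sublist {l₁ l : List α} (h : l₁.Sublist l) : size l₁ ≤ size l := by
  induction h with
  | slnil => exact le_rfl
  | cons a _ ih => simp; omega
  | cons_cons a _ ih => simp; omega

/-- The main stack starting with the word of the tree of an element. -/
abbrev top (x : α) (m : List Bool) : Store := base ((enc x).word ++ m)

/-- The program replaces `x` by `f x` in at most `t x` steps. -/
def Computes (p : Program) (f : α → β) (t : α → ℕ) : Prop :=
  ∀ x m, Runs p (top x m) (top (f x) m) (t x)

/-- The function `f` is computed by some program in time `t`. -/
def ComputesIn (f : α → β) (t : α → ℕ) : Prop := ∃ p, Computes p f t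

/-! ### Combinators with explicit time bounds -/

namespace ComputesIn

theorem recode {f : α → β} (h : ∀ x, enc (f x) = enc x) : ComputesIn f fun _ => 0 :=
  ⟨skip, fun x m => by rw [top, top, h]; exact .skip⟩

theorem const (c : β) : ComputesIn (fun _ : α => c) fun x => 6 * size x + 3 + size c :=
  ⟨drop ⨾ pushWord (enc c).word, fun _ _ =>
    runs_drop.seq ((runs_pushWord _).weaken (length_word _).le)⟩

theorem comp {g : β → γ} {f : α → β} {t : α → ℕ} {u : β → ℕ} (hg : ComputesIn g u)
    (hf : ComputesIn f t) : ComputesIn (fun x => g (f x)) fun x => t x + u (f x) := by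
  obtain ⟨p, hp⟩ := hf
  obtain ⟨q, hq⟩ := hg
  exact ⟨p ⨾ q, fun x m => (hp x m).seq (hq _ m)⟩

theorem pair {f : α → β} {g : α → γ} {t u : α → ℕ} (hf : ComputesIn f t) (hg : ComputesIn g u) :
    ComputesIn (fun x => (f x, g x)) fun x => t x + u x + 20 * size x + 7 * size (g x) + 20 := by
  obtain ⟨p, hp⟩ := hf
  obtain ⟨q, hq⟩ := hg
  -- The program for `g` uses one copy first and its result is put below the other; after `f`, the
  -- last bit joins both results under a node.
  refine ⟨dup ⨾ q ⨾ swap ⨾ p ⨾ push .M true, fun x m => ?_⟩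
  refine (runs_dup.seq ((hq x _).seq (runs_swap.seq ((hp x _).seq (Runs.push.congr ?_))))).weaken ?_
  · simp [top, enc_pair, word]
  · simp only [size]
    omega

theorem fst : ComputesIn (Prod.fst : α × β → α) fun x => 7 * size x + 7 :=
  ⟨left, fun ⟨a, b⟩ _ => runs_left_node.weaken (by simp only [size_pair]; simp only [size]; omega)⟩

theorem snd : ComputesIn (Prod.snd : α × β → β) fun x => 7 * size x + 7 :=
  ⟨right, fun ⟨a, b⟩ _ => runs_right_node.weaken (by simp only [size_pair]; simp only [size]; omega)⟩

theorem ite {c : α → Bool} {f g : α → β} {t u v : α → ℕ} (hc : ComputesIn c t)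
    (hf : ComputesIn f u) (hg : ComputesIn g v) :
    ComputesIn (fun x => if c x then f x else g x)
      fun x => t x + u x + v x + 12 * size x + 24 := by
  obtain ⟨p, hp⟩ := hc
  obtain ⟨q, hq⟩ := hf
  obtain ⟨r, hr⟩ := hg
  -- Popping the root bit of the tree of `true` leaves its two leaves behind, which must be dropped;
  -- the tree of `false` disappears entirely.
  refine ⟨dup ⨾ p ⨾ branch .M (drop ⨾ drop ⨾ q) r skip, fun x m => ?_⟩
  have hd : ∀ m, Runs drop (base (leaf.word ++ m)) (base m) 9 := fun m => runs_drop
  have hp := hp x ((enc x).word ++ m)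
  change Runs _ _ (top (if c x then f x else g x) m) _
  cases hx : c x
  · simp only [hx, top, enc_false] at hp
    rw [if_neg Bool.false_ne_true]
    exact (runs_dup.seq (hp.seq (Runs.branch_false rfl
      (by rw [update_store_M]; exact hr x m)))).weaken (by simp only [size]; omega)
  · simp only [hx, top, enc_true] at hp
    rw [if_pos rfl]
    exact (runs_dup.seq (hp.seq (Runs.branch_true rfl
      (by rw [update_store_M]; exact (hd _).seq ((hd _).seq (hq x m)))))).weaken
        (by simp only [size]; omega)

theorem equal {f g : α → β} {t u : α → ℕ} [DecidableEq β] (hf : ComputesIn f t)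
    (hg : ComputesIn g u) : ComputesIn (fun x => decide (f x = g x))
      fun x => t x + u x + 20 * size x + 20 * size (f x) + 20 * size (g x) + 40 := by
  obtain ⟨p, hp⟩ := hf.pair hg
  refine ⟨p ⨾ StackProgram.equal, fun x m =>
    ((hp x m).seq (runs_equal (r := decide (f x = g x)) ?_)).weaken ?_⟩
  · rw [decide_eq_true_iff, inj.eq_iff]
  · simp only [size]
    omega

/-- The root bit of the list decides. A nonempty list without its root bit is its head followed by
its tail; pushing the bit back makes them a pair, to which `x` is attached. `F` enters only through
its two equations, so it may be any function defined by cases. -/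
theorem list_cases {l : α → List β} {F g : α → γ} {h : α × β × List β → γ} {t u : α → ℕ}
    {v : α × β × List β → ℕ} (hl : ComputesIn l t) (hg : ComputesIn g u) (hh : ComputesIn h v)
    (h_nil : ∀ x, l x = [] → F x = g x) (h_cons : ∀ x a l', l x = a :: l' → F x = h (x, a, l'))
    {w : α → ℕ} (hw : ∀ x a l', l x = a :: l' → v (x, a, l') ≤ w x) :
    ComputesIn F fun x => t x + u x + w x + 20 * size x + 7 * size (l x) + 20 := by
  obtain ⟨p, hp⟩ := hl
  obtain ⟨q, hq⟩ := hg
  obtain ⟨r, hr⟩ := hh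
  refine ⟨dup ⨾ p ⨾ branch .M (push .M true ⨾ swap ⨾ push .M true ⨾ r) q skip, fun x m => ?_⟩
  have hp := hp x ((enc x).word ++ m)
  rcases hx : l x with _ | ⟨a, l'⟩
  · simp only [hx, top, enc_nil] at hp
    rw [h_nil x hx]
    exact (runs_dup.seq (hp.seq (Runs.branch_false rfl
      (by rw [update_store_M]; exact hq x m)))).weaken (by simp only [size]; omega)
  · simp only [hx, top, enc_cons] at hp
    rw [h_cons x a l' hx]
    have h₁ : Runs (push .M true) (base ((enc a).word ++ (enc l').word ++ ((enc x).word ++ m)))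
        (base ((node (enc a) (enc l')).word ++ ((enc x).word ++ m))) 1 :=
      Runs.push.congr (by simp [word])
    have h₂ : Runs (push .M true) (base ((enc x).word ++ ((node (enc a) (enc l')).word ++ m)))
        (top (x, a, l') m) 1 := Runs.push.congr (by simp [top, word, enc_pair])
    refine (runs_dup.seq (hp.seq (Runs.branch_true rfl
      (by rw [update_store_M]; exact h₁.seq (runs_swap.seq (h₂.seq (hr _ m))))))).weaken ?_
    have := hw x a l' hx
    have h₃ : size (l x) = size a + size l' + 1 := by rw [hx, size_cons]
    simp only [size, BinTree.size] at h₃ ⊢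
    omega

/-- The cons bits of the list drive the loop. After such a bit is popped, the stack holds head, tail
and accumulator; `under` brings the accumulator next to the head, and `swap` restores the invariant
that the list lies above the accumulator. Bounds are required only for accumulators that actually
occur. -/
theorem fold_aux {f : α × β → β} {t : α × β → ℕ} {p : Program} (hp : Computes p f t) (N B : ℕ)
    (m : List Bool) (l : List α) : ∀ b : β, size l ≤ N → size b ≤ B →
    (∀ l₁ a, l₁ ++ [a] <+: l → t (a, l₁.foldl (fun b a => f (a, b)) b) ≤ B ∧
      size ((l₁ ++ [a]).foldl (fun b a => f (a, b)) b) ≤ B) →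
    Runs (whileTrue .M (under ⨾ push .M true ⨾ p ⨾ swap))
      (base ((enc l).word ++ ((enc b).word ++ m))) (top (l.foldl (fun b a => f (a, b)) b) m)
      (l.length * (14 * N + 15 * B + 20) + 1) := by
  induction l with
  | nil =>
    intro b _ _ _
    exact ((Runs.while_false (l := (enc b).word ++ m) (by simp [enc_nil, word])).congr
      (update_store_M _ _ _ _ _ _)).weaken (by simp)
  | cons a l ih =>
    intro b hN hB h
    obtain ⟨h₁, h₂⟩ := h [] a (by simp)
    simp only [List.nil_append, List.foldl_cons, List.foldl_nil] at h₁ h₂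
    rw [size_cons] at hN
    have h₃ : Runs (push .M true) (base ((enc a).word ++ ((enc b).word ++ ((enc l).word ++ m))))
        (top (a, b) ((enc l).word ++ m)) 1 := Runs.push.congr (by simp [top, word, enc_pair])
    refine (Runs.while_true (l := (enc a).word ++ ((enc l).word ++ ((enc b).word ++ m)))
      (by simp [enc_cons, word]) (by
        rw [update_store_M]
        exact runs_under.seq (h₃.seq ((hp _ _).seq runs_swap)))
      (ih (f (a, b)) (by omega) h₂ fun l₁ a' h' =>
        h (a :: l₁) a' (by simpa using h'))).weaken ?_
    simp only [size] at hN hB h₂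
    rw [List.length_cons, add_one_mul]
    omega

theorem fold {f : α × β → β} {t : α × β → ℕ} (hf : ComputesIn f t) :
    ∃ p, ∀ (l : List α) (b : β) (B : ℕ), size b ≤ B →
      (∀ l₁ a, l₁ ++ [a] <+: l → t (a, l₁.foldl (fun b a => f (a, b)) b) ≤ B ∧
        size ((l₁ ++ [a]).foldl (fun b a => f (a, b)) b) ≤ B) →
      ∀ m, Runs p (top (l, b) m) (top (l.foldl (fun b a => f (a, b)) b) m)
        (size l * (14 * size l + 15 * B + 20) + 2) := by
  obtain ⟨p, hp⟩ := hf
  refine ⟨branch .M (whileTrue .M (under ⨾ push .M true ⨾ p ⨾ swap)) skip skip,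
    fun l b B hb h m => ?_⟩
  refine (Runs.branch_true (l := (enc l).word ++ ((enc b).word ++ m)) (by simp [enc_pair, word])
    (by rw [update_store_M]; exact fold_aux hp (size l) B m l b le_rfl hb h)).weaken ?_
  have := Nat.mul_le_mul_right (14 * size l + 15 * B + 20) (length_le_size l)
  omega

end ComputesIn

end StackProgram

namespace StackProgram

open Turing Function Program BinTree Enc

variable {α β γ δ : Type} [Enc α] [Enc β] [Enc γ] [Enc δ]

/-! ### Polynomial and exponential bounds -/

/-- The function is bounded by a polynomial in the size of the argument. -/
def PolyB (t : α → ℕ) : Prop := ∃ k, ∀ x, t x ≤ (size x + 1) ^ k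

/-- The function is bounded by an exponential of a polynomial in the size of the argument. -/
def ExpB (t : α → ℕ) : Prop := ∃ k, ∀ x, t x ≤ 2 ^ (size x + 1) ^ k

/-- Since the base is at least `2`, a pure power can absorb constants and sums; hence the simple
form of `PolyB`. -/
theorem two_le_size_add_one (x : α) : 2 ≤ size x + 1 := by
  have := one_le_size x
  omega

namespace PolyB

variable {t u : α → ℕ}

theorem mono (h : PolyB u) (htu : ∀ x, t x ≤ u x) : PolyB t := by
  obtain ⟨k, hk⟩ := h
  exact ⟨k, fun x => (htu x).trans (hk x)⟩

theorem const (c : ℕ) : PolyB fun _ : α => c :=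
  ⟨c, fun x => (Nat.lt_two_pow_self).le.trans (Nat.pow_le_pow_left (two_le_size_add_one x) c)⟩

theorem size : PolyB (size : α → ℕ) := ⟨1, fun x => by simp⟩

theorem mul (ht : PolyB t) (hu : PolyB u) : PolyB fun x => t x * u x := by
  obtain ⟨k, hk⟩ := ht
  obtain ⟨l, hl⟩ := hu
  exact ⟨k + l, fun x => by rw [pow_add]; exact Nat.mul_le_mul (hk x) (hl x)⟩

theorem add (ht : PolyB t) (hu : PolyB u) : PolyB fun x => t x + u x := by
  obtain ⟨k, hk⟩ := ht
  obtain ⟨l, hl⟩ := hu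
  refine ⟨max k l + 1, fun x => ?_⟩
  have h₁ := Nat.pow_le_pow_right (Nat.succ_pos (StackProgram.size x)) (le_max_left k l)
  have h₂ := Nat.pow_le_pow_right (Nat.succ_pos (StackProgram.size x)) (le_max_right k l)
  have h₃ := Nat.mul_le_mul_left ((StackProgram.size x + 1) ^ max k l) (two_le_size_add_one x)
  have := hk x
  have := hl x
  simp only [pow_succ, Nat.succ_eq_add_one] at h₁ h₂ ⊢
  omega

theorem pow (ht : PolyB t) (n : ℕ) : PolyB fun x => t x ^ n := by
  obtain ⟨k, hk⟩ := ht
  exact ⟨k * n, fun x => by rw [pow_mul]; exact Nat.pow_le_pow_left (hk x) n⟩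

theorem comp {u : β → ℕ} {f : α → β} (hu : PolyB u) (hf : PolyB fun x => StackProgram.size (f x)) :
    PolyB fun x => u (f x) := by
  obtain ⟨k, hk⟩ := hu
  exact ((hf.add (const 1)).pow k).mono fun x => hk (f x)

end PolyB

namespace ExpB

variable {t u : α → ℕ}

theorem mono (h : ExpB u) (htu : ∀ x, t x ≤ u x) : ExpB t := by
  obtain ⟨k, hk⟩ := h
  exact ⟨k, fun x => (htu x).trans (hk x)⟩

theorem two_pow (h : PolyB t) : ExpB fun x => 2 ^ t x := by
  obtain ⟨k, hk⟩ := h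
  exact ⟨k, fun x => Nat.pow_le_pow_right two_pos (hk x)⟩

theorem of_polyB (h : PolyB t) : ExpB t := (two_pow h).mono fun _ => Nat.lt_two_pow_self.le

theorem exists_polyB (h : ExpB t) : ∃ u : α → ℕ, PolyB u ∧ ∀ x, t x ≤ 2 ^ u x := by
  obtain ⟨k, hk⟩ := h
  exact ⟨_, ⟨k, fun _ => le_rfl⟩, hk⟩

theorem mul (ht : ExpB t) (hu : ExpB u) : ExpB fun x => t x * u x := by
  obtain ⟨t', ht', h⟩ := ht.exists_polyB
  obtain ⟨u', hu', h'⟩ := hu.exists_polyB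
  exact (two_pow (ht'.add hu')).mono fun x => by rw [pow_add]; exact Nat.mul_le_mul (h x) (h' x)

theorem add (ht : ExpB t) (hu : ExpB u) : ExpB fun x => t x + u x := by
  obtain ⟨t', ht', h⟩ := ht.exists_polyB
  obtain ⟨u', hu', h'⟩ := hu.exists_polyB
  refine (two_pow ((ht'.add hu').add (.const 1))).mono fun x => ?_
  have h₁ : 2 ^ t' x ≤ 2 ^ (t' x + u' x) := Nat.pow_le_pow_right two_pos (by omega)
  have h₂ : 2 ^ u' x ≤ 2 ^ (t' x + u' x) := Nat.pow_le_pow_right two_pos (by omega)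
  have := h x
  have := h' x
  rw [pow_succ]
  omega

theorem pow (ht : ExpB t) (n : ℕ) : ExpB fun x => t x ^ n := by
  obtain ⟨t', ht', h⟩ := ht.exists_polyB
  exact (two_pow (ht'.mul (.const n))).mono fun x => by
    rw [pow_mul]
    exact Nat.pow_le_pow_left (h x) n

theorem comp {u : β → ℕ} {f : α → β} (hu : PolyB u) (hf : ExpB fun x => size (f x)) :
    ExpB fun x => u (f x) := by
  obtain ⟨k, hk⟩ := hu
  exact ((hf.add (of_polyB (.const 1))).pow k).mono fun x => hk (f x)

end ExpB

/-- The function is computed in polynomial time. -/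
@[fun_prop]
structure PolyTime (f : α → β) : Prop where
  time : ∃ t, ComputesIn f t ∧ PolyB t
  size : PolyB fun x => size (f x)

/-- The function is computed in exponential time. -/
structure ExpTime (f : α → β) : Prop where
  time : ∃ t, ComputesIn f t ∧ ExpB t
  size : ExpB fun x => size (f x)

/-! ### Folds -/

theorem ComputesIn.foldl {l : γ → List α} {b : γ → β} {f : γ → β → α → β} {tl tb : γ → ℕ}
    {tf : (γ × β) × α → ℕ} (hl : ComputesIn l tl) (hb : ComputesIn b tb)
    (hf : ComputesIn (fun p : (γ × β) × α => f p.1.1 p.1.2 p.2) tf) {B T : γ → ℕ}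
    (h : ∀ x l₁, l₁ <+: l x → size (l₁.foldl (f x) (b x)) ≤ B x)
    (h' : ∀ x b a, a ∈ l x → size b ≤ B x → tf ((x, b), a) ≤ T x) :
    ComputesIn (fun x => (l x).foldl (f x) (b x))
      fun x => tl x + tb x + 50000 * (size x + size (l x) + B x + T x + 1) ^ 2 := by
  -- The step function depends on the parameter `x`, so the fold is run on the accumulator `(x, b)`.
  have hx : ComputesIn (fun p : α × γ × β => p.2.1) _ := .comp .fst .snd
  obtain ⟨p, hp⟩ := ComputesIn.fold (hx.pair (hf.comp ((hx.pair (.comp .snd .snd)).pair .fst)))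
  obtain ⟨q, hq⟩ := hl.pair ((ComputesIn.recode (fun x : γ => rfl)).pair hb)
  obtain ⟨r, hr⟩ := ComputesIn.snd (α := γ) (β := β)
  have key : ∀ x (b : β) (l : List α), l.foldl (fun (c : γ × β) a => (c.1, f c.1 c.2 a)) (x, b) =
      (x, l.foldl (f x) b) := by
    intro x b l
    induction l generalizing b with
    | nil => rfl
    | cons a l ih => exact ih _
  refine ⟨q ⨾ p ⨾ r, fun x m => ?_⟩
  have h₀ := h x [] (List.nil_prefix)
  have hfin := h x _ (List.prefix_refl _)
  simp only [List.foldl_nil] at h₀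
  -- One bound must cover both the cost of a step and the accumulator size; the factor `500`
  -- generously absorbs the linear overhead of projections and pairings.
  have hp' := hp (l x) (x, b x) (500 * (size x + size (l x) + B x + T x + 1)) (by simp; omega) (by
    intro l₁ a hl₁
    have h₁ := h x _ ((List.prefix_append l₁ [a]).trans hl₁)
    have ha : a ∈ l x := hl₁.subset (by simp)
    have h₂ := h' x _ a ha h₁
    have h₃ := h x _ hl₁
    have h₄ := size_le_of_mem ha
    simp only [key, size_pair]
    simp only [List.foldl_append, List.foldl_cons, List.foldl_nil] at h₃ ⊢
    omega) m
  simp only [key] at hp'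
  refine ((hq x m).seq (hp'.seq (hr _ m))).weaken ?_
  simp only [size_pair]
  set Q := size x + size (l x) + B x + T x + 1 with hQ
  have h₁ : size (l x) * (14 * size (l x) + 15 * (500 * Q) + 20) ≤ Q * (7600 * Q) :=
    Nat.mul_le_mul (by omega) (by omega)
  have h₂ : Q ≤ Q * Q := Nat.le_mul_of_pos_left _ (by omega)
  have h₃ : Q * (7600 * Q) = 7600 * (Q * Q) := by ring
  rw [pow_two]
  omega

/-! ### Closure properties of polynomial time -/

namespace PolyTime

@[fun_prop]
theorem id : PolyTime fun x : α => x := ⟨⟨_, .recode fun _ => rfl, .const 0⟩, .size⟩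

theorem recode {f : α → β} (h : ∀ x, enc (f x) = enc x) : PolyTime f :=
  ⟨⟨_, .recode h, .const 0⟩, PolyB.size.mono fun x => by
    rw [StackProgram.size, h, StackProgram.size]⟩

@[fun_prop]
theorem const (c : β) : PolyTime fun _ : α => c :=
  ⟨⟨_, .const c, (((PolyB.const 6).mul .size).add (.const 3)).add (.const _)⟩, .const _⟩

@[fun_prop]
theorem comp {g : β → γ} {f : α → β} (hg : PolyTime g) (hf : PolyTime f) :
    PolyTime fun x => g (f x) := by
  obtain ⟨⟨t, ht, ht'⟩, hsf⟩ := hf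
  obtain ⟨⟨u, hu, hu'⟩, hsg⟩ := hg
  exact ⟨⟨_, hu.comp ht, ht'.add (hu'.comp hsf)⟩, hsg.comp hsf⟩

@[fun_prop]
theorem pair {f : α → β} {g : α → γ} (hf : PolyTime f) (hg : PolyTime g) :
    PolyTime fun x => (f x, g x) := by
  obtain ⟨⟨t, ht, ht'⟩, hsf⟩ := hf
  obtain ⟨⟨u, hu, hu'⟩, hsg⟩ := hg
  exact ⟨⟨_, ht.pair hu, (((ht'.add hu').add ((PolyB.const 20).mul .size)).add
    ((PolyB.const 7).mul hsg)).add (.const 20)⟩, (hsf.add hsg).add (.const 1)⟩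

@[fun_prop]
theorem fst : PolyTime (Prod.fst : α × β → α) :=
  ⟨⟨_, .fst, ((PolyB.const 7).mul .size).add (.const 7)⟩,
    PolyB.size.mono fun ⟨a, b⟩ => by simp; omega⟩

@[fun_prop]
theorem snd : PolyTime (Prod.snd : α × β → β) :=
  ⟨⟨_, .snd, ((PolyB.const 7).mul .size).add (.const 7)⟩,
    PolyB.size.mono fun ⟨a, b⟩ => by simp; omega⟩

@[fun_prop]
theorem ite {c : α → Bool} {f g : α → β} (hc : PolyTime c) (hf : PolyTime f) (hg : PolyTime g) :
    PolyTime fun x => if c x then f x else g x := by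
  obtain ⟨⟨t, ht, ht'⟩, -⟩ := hc
  obtain ⟨⟨u, hu, hu'⟩, hsf⟩ := hf
  obtain ⟨⟨v, hv, hv'⟩, hsg⟩ := hg
  exact ⟨⟨_, ht.ite hu hv, (((ht'.add hu').add hv').add ((PolyB.const 12).mul .size)).add
    (.const 24)⟩,
    (hsf.add hsg).mono fun x => by split_ifs <;> omega⟩

theorem of_bool {f : α → Bool} {t : α → ℕ} (h : ComputesIn f t) (ht : PolyB t) : PolyTime f :=
  ⟨⟨t, h, ht⟩, (PolyB.const 3).mono fun _ => size_bool_le _⟩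

@[fun_prop]
theorem equal [DecidableEq β] {f g : α → β} (hf : PolyTime f) (hg : PolyTime g) :
    PolyTime fun x => decide (f x = g x) := by
  obtain ⟨⟨t, ht, ht'⟩, hsf⟩ := hf
  obtain ⟨⟨u, hu, hu'⟩, hsg⟩ := hg
  exact of_bool (ht.equal hu) (((((ht'.add hu').add ((PolyB.const 20).mul .size)).add
    ((PolyB.const 20).mul hsf)).add ((PolyB.const 20).mul hsg)).add (.const 40))

theorem list_cases {l : α → List β} {F g : α → γ} {h : α × β × List β → γ} (hl : PolyTime l)
    (hg : PolyTime g) (hh : PolyTime h) (h_nil : ∀ x, l x = [] → F x = g x)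
    (h_cons : ∀ x a l', l x = a :: l' → F x = h (x, a, l')) : PolyTime F := by
  obtain ⟨⟨t, ht, ht'⟩, hsl⟩ := hl
  obtain ⟨⟨u, hu, hu'⟩, hsg⟩ := hg
  obtain ⟨⟨v, hv, k, hk⟩, k', hk'⟩ := hh
  have hs : ∀ x a l', l x = a :: l' →
      StackProgram.size (x, a, l') = StackProgram.size x + StackProgram.size (l x) + 1 := by
    intro x a l' e
    rw [e, size_pair, size_pair, size_cons]
  have hB := (PolyB.size.add hsl).add (.const 2)
  refine ⟨⟨_, ht.list_cases hu hv h_nil h_cons fun x a l' e =>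
    (hk _).trans (by rw [hs x a l' e]), ((((ht'.add hu').add (hB.pow k)).add
      ((PolyB.const 20).mul .size)).add ((PolyB.const 7).mul hsl)).add (.const 20)⟩,
    (hsg.add (hB.pow k')).mono fun x => ?_⟩
  rcases hx : l x with _ | ⟨a, l'⟩
  · rw [h_nil x hx]
    omega
  · rw [h_cons x a l' hx]
    have h₁ : StackProgram.size (h (x, a, l')) ≤ _ := hk' (x, a, l')
    rw [hs x a l' hx, hx] at h₁
    exact h₁.trans (Nat.le_add_left _ _)

/-- Polynomial-time steps alone do not suffice, as an accumulator could double in each of them. A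
polynomial bound on all partial folds is what keeps every step cheap. -/
theorem foldl {l : γ → List α} {b : γ → β} {f : γ → β → α → β} (hl : PolyTime l) (hb : PolyTime b)
    (hf : PolyTime (fun p : (γ × β) × α => f p.1.1 p.1.2 p.2)) {B : γ → ℕ} (hB : PolyB B)
    (h : ∀ x l₁, l₁ <+: l x → StackProgram.size (l₁.foldl (f x) (b x)) ≤ B x) :
    PolyTime fun x => (l x).foldl (f x) (b x) := by
  obtain ⟨⟨tl, htl, htl'⟩, hsl⟩ := hl
  obtain ⟨⟨tb, htb, htb'⟩, hsb⟩ := hb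
  obtain ⟨⟨tf, htf, k, hk⟩, hsf⟩ := hf
  have hT := (((PolyB.size.add hB).add hsl).add (.const 3)).pow k
  refine ⟨⟨_, htl.foldl htb htf h fun x b a ha hbs => (hk _).trans (Nat.pow_le_pow_left ?_ k),
    (htl'.add htb').add ((PolyB.const 50000).mul
      ((((PolyB.size.add hsl).add hB).add hT).add (.const 1) |>.pow 2))⟩,
    hB.mono fun x => h x _ (List.prefix_refl _)⟩
  have := size_le_of_mem ha
  simp only [size_pair]
  omega

theorem congr {f g : α → β} (h : PolyTime g) (e : ∀ x, f x = g x) : PolyTime f := by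
  rwa [show f = g from funext e]

/-- If the growth in each step is bounded independently of the accumulator, then all partial folds
are bounded by the start plus the number of steps times the largest increment. -/
theorem foldl_of_increment {l : γ → List α} {b : γ → β} {f : γ → β → α → β} (hl : PolyTime l)
    (hb : PolyTime b) (hf : PolyTime (fun p : (γ × β) × α => f p.1.1 p.1.2 p.2)) {c : γ × α → ℕ}
    (hc : PolyB c) (h : ∀ x b a, StackProgram.size (f x b a) ≤ StackProgram.size b + c (x, a)) :
    PolyTime fun x => (l x).foldl (f x) (b x) := by
  obtain ⟨k, hk⟩ := hc
  refine hl.foldl hb hf (B := fun x => StackProgram.size (b x) + StackProgram.size (l x) *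
    (StackProgram.size x + StackProgram.size (l x) + 2) ^ k)
    (hb.size.add (hl.size.mul (((PolyB.size.add hl.size).add (.const 2)).pow k)))
    fun x l₁ hl₁ => ?_
  have key : ∀ (l₂ : List α) (b : β), (∀ a ∈ l₂, a ∈ l x) → StackProgram.size (l₂.foldl (f x) b) ≤
      StackProgram.size b + l₂.length *
        (StackProgram.size x + StackProgram.size (l x) + 2) ^ k := by
    intro l₂
    induction l₂ with
    | nil => simp
    | cons a l₂ ih =>
      intro b h₂
      have h₃ := ih (f x b a) fun a' h' => h₂ a' (List.mem_cons_of_mem _ h')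
      have h₄ := h x b a
      have h₅ : c (x, a) ≤ (StackProgram.size x + StackProgram.size (l x) + 2) ^ k := by
        refine (hk _).trans (Nat.pow_le_pow_left ?_ k)
        have := size_le_of_mem (h₂ a List.mem_cons_self)
        simp only [size_pair]
        omega
      rw [List.foldl_cons, List.length_cons, add_one_mul]
      omega
  refine (key l₁ (b x) fun a ha => hl₁.subset ha).trans (Nat.add_le_add_left
    (Nat.mul_le_mul_right _ ?_) _)
  exact (length_le_size l₁).trans (size_prefix hl₁)

@[fun_prop]
theorem cons {f : α → β} {g : α → List β} (hf : PolyTime f) (hg : PolyTime g) :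
    PolyTime fun x => f x :: g x := by
  have : PolyTime fun p : β × List β => p.1 :: p.2 := .recode fun _ => rfl
  exact this.comp (hf.pair hg)

@[fun_prop]
theorem reverse {l : α → List β} (hl : PolyTime l) : PolyTime fun x => (l x).reverse := by
  refine congr (g := fun x => (l x).foldl (fun acc a => a :: acc) []) ?_ fun x => by simp
  exact foldl_of_increment (c := fun p => StackProgram.size p.2 + 1) hl (.const _) (by fun_prop)
    ((snd.size).add (.const 1)) fun x b a => by simp; omega

@[fun_prop]
theorem append {l₁ l₂ : α → List β} (h₁ : PolyTime l₁) (h₂ : PolyTime l₂) :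
    PolyTime fun x => l₁ x ++ l₂ x := by
  refine congr (g := fun x => (l₁ x).reverse.foldl (fun acc a => a :: acc) (l₂ x)) ?_
    fun x => by simp
  exact foldl_of_increment (c := fun p => StackProgram.size p.2 + 1) (by fun_prop) h₂ (by fun_prop)
    ((snd.size).add (.const 1)) fun x b a => by simp; omega

@[fun_prop]
theorem flatMap {l : γ → List α} {f : γ → α → List β} (hl : PolyTime l)
    (hf : PolyTime (fun p : γ × α => f p.1 p.2)) : PolyTime fun x => (l x).flatMap (f x) := by
  have key : ∀ x (l : List α) acc, l.foldl (fun acc a => acc ++ f x a) acc =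
      acc ++ l.flatMap (f x) := by
    intro x l
    induction l with
    | nil => simp
    | cons a l ih => simp [ih]
  refine congr (g := fun x => (l x).foldl (fun acc a => acc ++ f x a) []) ?_ fun x => by simp [key]
  refine foldl_of_increment (c := fun p => StackProgram.size (f p.1 p.2)) hl (.const _) ?_ hf.size
    fun x b a => by
      have := size_append b (f x a)
      dsimp only
      omega
  have : PolyTime fun p : (γ × List β) × α => f p.1.1 p.2 :=
    hf.comp (f := fun p : (γ × List β) × α => (p.1.1, p.2)) (by fun_prop)
  fun_prop

@[fun_prop]
theorem map {l : γ → List α} {f : γ → α → β} (hl : PolyTime l)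
    (hf : PolyTime (fun p : γ × α => f p.1 p.2)) : PolyTime fun x => (l x).map (f x) := by
  refine congr (g := fun x => (l x).flatMap fun a => [f x a]) ?_
    fun x => by rw [← List.flatMap_singleton' (List.map _ _), List.flatMap_map]
  exact hl.flatMap (by fun_prop)

@[fun_prop]
theorem filter {l : γ → List α} {f : γ → α → Bool} (hl : PolyTime l)
    (hf : PolyTime (fun p : γ × α => f p.1 p.2)) : PolyTime fun x => (l x).filter (f x) := by
  have key : ∀ x (l : List α), l.filter (f x) = l.flatMap fun a => if f x a then [a] else [] := by
    intro x l
    induction l with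
    | nil => rfl
    | cons a l ih => by_cases h : f x a <;> simp [h, ih]
  exact congr (hl.flatMap (by fun_prop)) fun x => key x (l x)

@[fun_prop]
theorem isEmpty {l : α → List β} (hl : PolyTime l) : PolyTime fun x => (l x).isEmpty :=
  hl.list_cases (.const true) (.const false) (fun x h => by simp [h]) fun x a l' h => by simp [h]

@[fun_prop]
theorem tail {l : α → List β} (hl : PolyTime l) : PolyTime fun x => (l x).tail :=
  hl.list_cases (.const []) (h := fun p => p.2.2) (by fun_prop) (fun x h => by simp [h])
    fun x a l' h => by simp [h]

@[fun_prop]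
theorem headD {l : α → List β} {b : α → β} (hl : PolyTime l) (hb : PolyTime b) :
    PolyTime fun x => (l x).headD (b x) :=
  hl.list_cases hb (h := fun p => p.2.1) (by fun_prop) (fun x h => by simp [h])
    fun x a l' h => by simp [h]

@[fun_prop]
theorem not {f : α → Bool} (hf : PolyTime f) : PolyTime fun x => !f x :=
  congr (hf.ite (.const false) (.const true)) fun x => by cases f x <;> rfl

@[fun_prop]
theorem and {f g : α → Bool} (hf : PolyTime f) (hg : PolyTime g) : PolyTime fun x => f x && g x :=
  congr (hf.ite hg (.const false)) fun x => by cases f x <;> rfl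

@[fun_prop]
theorem or {f g : α → Bool} (hf : PolyTime f) (hg : PolyTime g) : PolyTime fun x => f x || g x :=
  congr (hf.ite (.const true) hg) fun x => by cases f x <;> rfl

@[fun_prop]
theorem any {l : γ → List α} {f : γ → α → Bool} (hl : PolyTime l)
    (hf : PolyTime (fun p : γ × α => f p.1 p.2)) : PolyTime fun x => (l x).any (f x) := by
  have h := (hl.filter hf).isEmpty.not
  refine congr h fun x => ?_
  rw [Bool.eq_iff_iff]
  simp

@[fun_prop]
theorem all {l : γ → List α} {f : γ → α → Bool} (hl : PolyTime l)
    (hf : PolyTime (fun p : γ × α => f p.1 p.2)) : PolyTime fun x => (l x).all (f x) :=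
  congr (hl.any (f := fun x a => !f x a) hf.not).not fun x => by simp [List.all_eq_not_any_not]

@[fun_prop]
theorem mem {f : α → β} {l : α → List β} [∀ x, Decidable (f x ∈ l x)] (hf : PolyTime f)
    (hl : PolyTime l) : PolyTime fun x => decide (f x ∈ l x) := by
  classical
  refine congr (hl.any (f := fun x b => decide (f x = b)) (by fun_prop)) fun x => ?_
  rw [Bool.eq_iff_iff]
  simp

@[fun_prop]
theorem length {l : α → List β} (hl : PolyTime l) : PolyTime fun x => (l x).length := by
  -- A list of units and its length have the same tree, so numbers inherit list operations at no
  -- cost.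
  have h : PolyTime fun l : List Unit => l.length := .recode fun l => by
    induction l with
    | nil => rfl
    | cons a l ih => exact congrArg _ ih
  exact congr (h.comp (hl.map (f := fun _ _ => ()) (.const _))) fun x => by simp

@[fun_prop]
theorem units {n : α → ℕ} (hn : PolyTime n) : PolyTime fun x => List.replicate (n x) () := by
  have h : PolyTime fun n : ℕ => List.replicate n () := .recode fun n => by
    induction n with
    | zero => rfl
    | succ n ih => exact congrArg _ ih
  exact h.comp hn

@[fun_prop]
theorem succ {n : α → ℕ} (hn : PolyTime n) : PolyTime fun x => n x + 1 :=
  congr ((PolyTime.const ()).cons hn.units).length fun x => by simp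

@[fun_prop]
theorem replicate {n : α → ℕ} {b : α → β} (hn : PolyTime n) (hb : PolyTime b) :
    PolyTime fun x => List.replicate (n x) (b x) :=
  congr (hn.units.map (f := fun x _ => b x) (by fun_prop)) fun x => by simp

@[fun_prop]
theorem drop {n : α → ℕ} {l : α → List β} (hn : PolyTime n) (hl : PolyTime l) :
    PolyTime fun x => (l x).drop (n x) := by
  have key : ∀ (n : ℕ) (l : List β), l.drop n = (List.replicate n ()).foldl (fun l _ => l.tail) l := by
    intro n
    induction n with
    | zero => simp
    | succ n ih => intro l; rw [List.replicate_succ, List.foldl_cons, ← ih]; simp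
  refine congr (hn.units.foldl_of_increment (c := fun _ => 0) (f := fun _ l _ => l.tail) hl
    (by fun_prop) (.const 0) fun x l a => ?_) fun x => key _ _
  exact size_sublist (List.tail_sublist l)

@[fun_prop]
theorem take {n : α → ℕ} {l : α → List β} (hn : PolyTime n) (hl : PolyTime l) :
    PolyTime fun x => (l x).take (n x) :=
  congr (g := fun x => ((l x).reverse.drop ((l x).drop (n x)).length).reverse) (by fun_prop)
    fun x => by
      rw [List.drop_reverse, List.reverse_reverse, List.length_drop]
      rcases le_total (n x) (l x).length with h | h
      · congr 1
        omega
      · rw [Nat.sub_eq_zero_of_le h, List.take_of_length_le h, Nat.sub_zero, List.take_length]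

@[fun_prop]
theorem range {n : α → ℕ} (hn : PolyTime n) : PolyTime fun x => List.range (n x) := by
  have key : ∀ n : ℕ, List.range n = (List.replicate n ()).foldl (fun l _ => l ++ [l.length]) [] := by
    intro n
    induction n with
    | zero => rfl
    | succ n ih => rw [List.replicate_succ', List.foldl_append, ← ih]; simp [List.range_succ]
  -- The increment `[l.length]` grows with the accumulator, so `foldl_of_increment` does not apply;
  -- the size is bounded directly by a quadratic polynomial.
  have hsize : ∀ n : ℕ, StackProgram.size (List.range n) ≤ (2 * n + 2) * n + 1 := by
    intro n
    induction n with
    | zero => simp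
    | succ n ih =>
      have := size_append (List.range n) [n]
      rw [List.range_succ]
      simp only [size_cons, size_nil, size_nat] at this
      nlinarith
  refine congr (hn.units.foldl (b := fun _ => []) (f := fun _ l _ => l ++ [l.length]) (.const _)
    (by fun_prop) (B := fun x => (2 * StackProgram.size (n x) + 2) * StackProgram.size (n x) + 1)
    (((((PolyB.const 2).mul hn.size).add (.const 2)).mul hn.size).add (.const 1))
    fun x l₁ hl₁ => ?_) fun x => key _
  obtain ⟨h₁, h₂⟩ := List.prefix_replicate_iff.1 hl₁
  rw [h₂, ← key]
  refine (hsize _).trans ?_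
  have h₃ : l₁.length ≤ StackProgram.size (n x) := by
    rw [size_nat]
    omega
  gcongr

end PolyTime

/-! ### Closure properties of exponential time -/

namespace ExpTime

theorem of_polyTime {f : α → β} (h : PolyTime f) : ExpTime f := by
  obtain ⟨⟨t, ht, ht'⟩, hs⟩ := h
  exact ⟨⟨t, ht, .of_polyB ht'⟩, .of_polyB hs⟩

/-- A power of `2 ^ p` is again `2` to a multiple of `p`. So a polynomial-time pass over
exponentially long data is exponential in the original input. -/
theorem polyTime_comp {g : β → γ} {f : α → β} (hg : PolyTime g) (hf : ExpTime f) :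
    ExpTime fun x => g (f x) := by
  obtain ⟨⟨t, ht, ht'⟩, hsf⟩ := hf
  obtain ⟨⟨u, hu, hu'⟩, hsg⟩ := hg
  exact ⟨⟨_, hu.comp ht, ht'.add (.comp hu' hsf)⟩,
    .comp (u := fun y => StackProgram.size (g y)) hsg hsf⟩

theorem pair {f : α → β} {g : α → γ} (hf : ExpTime f) (hg : ExpTime g) :
    ExpTime fun x => (f x, g x) := by
  obtain ⟨⟨t, ht, ht'⟩, hsf⟩ := hf
  obtain ⟨⟨u, hu, hu'⟩, hsg⟩ := hg
  have hc : ∀ n, ExpB fun _ : α => n := fun n => .of_polyB (.const n)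
  exact ⟨⟨_, ht.pair hu, (((ht'.add hu').add ((hc 20).mul (.of_polyB .size))).add
    ((hc 7).mul hsg)).add (hc 20)⟩, (hsf.add hsg).add (hc 1)⟩

theorem foldl {l : γ → List α} {b : γ → β} {f : γ → β → α → β} (hl : PolyTime l) (hb : PolyTime b)
    (hf : PolyTime (fun p : (γ × β) × α => f p.1.1 p.1.2 p.2)) {B : γ → ℕ} (hB : ExpB B)
    (h : ∀ x l₁, l₁ <+: l x → StackProgram.size (l₁.foldl (f x) (b x)) ≤ B x) :
    ExpTime fun x => (l x).foldl (f x) (b x) := by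
  obtain ⟨⟨tl, htl, htl'⟩, hsl⟩ := hl
  obtain ⟨⟨tb, htb, htb'⟩, hsb⟩ := hb
  obtain ⟨⟨tf, htf, k, hk⟩, hsf⟩ := hf
  have hsl := ExpB.of_polyB hsl
  have hc : ∀ n, ExpB fun _ : γ => n := fun n => .of_polyB (.const n)
  have hs : ExpB (StackProgram.size : γ → ℕ) := .of_polyB .size
  have hT := (((hs.add hB).add hsl).add (hc 3)).pow k
  refine ⟨⟨_, htl.foldl htb htf h fun x b a ha hbs => (hk _).trans (Nat.pow_le_pow_left ?_ k),
    (ExpB.of_polyB (htl'.add htb')).add ((hc 50000).mul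
      ((((hs.add hsl).add hB).add hT).add (hc 1) |>.pow 2))⟩,
    hB.mono fun x => h x _ (List.prefix_refl _)⟩
  have := size_le_of_mem ha
  simp only [size_pair]
  omega

end ExpTime

/-! ### Programs on words -/

/-- Push a truth value in front of a list. -/
def consBit : Program :=
  drain .A (pushWord (true :: (enc true).word)) (pushWord (true :: (enc false).word))

theorem runs_consBit (a : List Bool) : ∀ l : List Bool,
    Runs consBit (store (enc l).word a [] [] []) (base (enc (a.reverse ++ l)).word)
      (5 * a.length + 1) := by
  induction a with
  | nil => exact fun l => .drain_nil rfl
  | cons x a ih =>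
    intro l
    have h := ih (x :: l)
    have hp : ∀ w m, Runs (pushWord w) (store m a [] [] []) (store (w ++ m) a [] [] [])
        w.length := by
      intro w m
      induction w with
      | nil => exact .skip
      | cons b w ihw => exact (ihw.seq .push).congr (by simp)
    rw [List.reverse_cons, List.append_assoc, List.singleton_append, List.length_cons]
    cases x
    · exact (Runs.drain_false (l := a) rfl (by rw [update_store_A]; exact hp _ _) h).weaken
        (by simp [enc_false, BinTree.size]; omega)
    · exact (Runs.drain_true (l := a) rfl (by rw [update_store_A]; exact hp _ _) h).weaken
        (by simp [enc_true, BinTree.size]; omega)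

/-- Replace a word by the word of its tree. -/
def encodeInput : Program := pour .M .A ⨾ push .M false ⨾ consBit

theorem runs_encodeInput (w : List Bool) :
    Runs encodeInput (base w) (base (enc w).word) (7 * w.length + 3) := by
  have h : Runs (pour .M .A) (base w) (store [] w.reverse [] [] []) (2 * w.length + 1) :=
    (runs_pour (by decide) w (base w) rfl).congr (by simp)
  have h' := runs_consBit w.reverse []
  rw [List.reverse_reverse, List.append_nil, List.length_reverse] at h'
  exact (h.seq ((Runs.push.congr (update_store_M _ _ _ _ _ _)).seq h')).weaken
    (n := 2 * w.length + 1 + (1 + (5 * w.length + 1)))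
    (by omega)

/-- Replace the tree of a truth value by the truth value. -/
def decodeOutput : Program := branch .M (clear .M ⨾ push .M true) (push .M false) skip

theorem runs_decodeOutput (b : Bool) : Runs decodeOutput (base (enc b).word) (base [b]) 5 := by
  cases b
  · exact (Runs.branch_false (l := []) rfl (Runs.push.congr (by simp))).weaken (by omega)
  · refine (Runs.branch_true (l := [false, false]) rfl (n := 4) ?_)
    rw [update_store_M]
    exact ((runs_clear _ _ rfl).congr (update_store_M _ _ _ _ _ _)).seq
      (Runs.push.congr (by simp))

theorem size_word_le (w : List Bool) : size w ≤ 4 * w.length + 1 := by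
  induction w with
  | nil => simp
  | cons b w ih =>
    have := size_bool_le b
    rw [size_cons, List.length_cons]
    omega

theorem ExpTime.inEXPTIME {f : List Bool → Bool} (hf : ExpTime f) {L : Language Bool}
    (hL : ∀ w, f w = true ↔ w ∈ L) : InEXPTIME L := by
  obtain ⟨⟨t, ⟨p, hp⟩, k, hk⟩, -⟩ := hf
  refine ⟨f, computableInTime (encodeInput ⨾ p ⨾ decodeOutput) f
    (fun n => 7 * n + 8 + 2 ^ (4 * n + 2) ^ k) fun w => ?_,
    -- The tree of a word `w` has size at most `4 * w.length + 1`, which gives the first summand;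
    -- the second absorbs the linear cost of input and output conversion and the halting step.
    (4 * .X + 2) ^ k + (7 * .X + 9), hL, fun n => ?_⟩
  · have h := hp w []
    simp only [top, List.append_nil] at h
    refine ((runs_encodeInput w).seq (h.seq (runs_decodeOutput (f w)))).weaken ?_
    have h₁ : (StackProgram.size w + 1) ^ k ≤ (4 * w.length + 2) ^ k :=
      Nat.pow_le_pow_left (by have := size_word_le w; omega) k
    have h₂ := (hk w).trans (Nat.pow_le_pow_right two_pos h₁)
    omega
  · have h₁ : 7 * n + 9 < 2 ^ (7 * n + 9) := Nat.lt_two_pow_self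
    have h₂ : 1 ≤ 2 ^ (4 * n + 2) ^ k := Nat.one_le_two_pow
    simp only [computableInTime, Polynomial.eval_add, Polynomial.eval_pow, Polynomial.eval_mul,
      Polynomial.eval_X, Polynomial.eval_ofNat, pow_add]
    rw [pow_add] at h₁
    nlinarith

end StackProgram

namespace SwitchingGame

/-! ### Determinacy -/

section Determinacy

variable {V : Type} [DecidableEq V] {G : SwitchingGame V}

/-- From the state `q` the reachability player can enforce that the target is reached in fewer
than `k` moves. -/
def Attr (G : SwitchingGame V) : ℕ → G.State → Prop
  | 0, _ => False
  | k + 1, q => q.1 = G.t ∨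
      (G.kind q.1 = .reach ∧ ∃ q', G.Step q q' ∧ Attr G k q') ∨
      (G.kind q.1 ≠ .reach ∧ (∃ q', G.Step q q') ∧ ∀ q', G.Step q q' → Attr G k q')

theorem Attr.succ {k : ℕ} {q : G.State} (h : G.Attr k q) : G.Attr (k + 1) q := by
  induction k generalizing q with
  | zero => exact h.elim
  | succ k ih =>
    rcases h with h | ⟨h, q', h₁, h₂⟩ | ⟨h, h₁, h₂⟩
    · exact .inl h
    · exact .inr (.inl ⟨h, q', h₁, ih h₂⟩)
    · exact .inr (.inr ⟨h, h₁, fun q' h' => ih (h₂ q' h')⟩)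

theorem Attr.mono {k l : ℕ} {q : G.State} (h : G.Attr k q) (hkl : k ≤ l) : G.Attr l q := by
  induction hkl with
  | refl => exact h
  | step _ ih => exact ih.succ

theorem Step.mem_edges {q q' : G.State} (h : G.Step q q') : (q.1, q'.1) ∈ G.E := by
  rcases h with h | ⟨h, h₁, -⟩
  · exact h.2.1
  · exact (G.mem_ord ⟨q.1, h⟩ q'.1).1 (List.mem_of_getElem? h₁)

theorem Step.hasOut {q q' : G.State} (h : G.Step q q') : G.HasOut q.1 := ⟨_, h.mem_edges⟩

theorem step_iff_of_ne_switch {q q' : G.State} (h : G.kind q.1 ≠ .switch) :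
    G.Step q q' ↔ (q.1, q'.1) ∈ G.E ∧ q'.2 = q.2 := by
  simp [Step, h]

theorem Step.unique {q q₁ q₂ : G.State} (h : G.kind q.1 = .switch) (h₁ : G.Step q q₁)
    (h₂ : G.Step q q₂) : q₁ = q₂ := by
  rcases h₁ with h₁ | ⟨_, h₁, h₁'⟩
  · exact absurd h h₁.1
  rcases h₂ with h₂ | ⟨_, h₂, h₂'⟩
  · exact absurd h h₂.1
  exact Prod.ext (Option.some_injective _ (h₁.symm.trans h₂)) (h₁'.trans h₂'.symm)

theorem Attr.exists_step {k : ℕ} {q : G.State} (h : G.Attr k q) (ht : q.1 ≠ G.t) :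
    ∃ q', G.Step q q' := by
  cases k with
  | zero => exact h.elim
  | succ k =>
    rcases h with h | ⟨_, q', h₁, _⟩ | ⟨_, h₁, _⟩
    · exact absurd h ht
    · exact ⟨q', h₁⟩
    · exact h₁

open Classical in
/-- The strategy that goes to a vertex from which a property of the next state holds, whenever
this is possible. -/
noncomputable def chooseStrategy (G : SwitchingGame V) (k : VertexKind)
    (P : G.State → G.State → Prop) : G.Strategy k where
  move h := match h.getLast? with
    | none => G.t
    | some q =>
      if h₁ : ∃ q', G.Step q q' ∧ P q q' then h₁.choose.1
      else if h₂ : G.HasOut q.1 then h₂.choose else G.t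
  legal h q hq h₂ := by
    simp only [List.getLast?_append, List.getLast?_singleton, Option.some_or]
    split_ifs with h₁
    · exact h₁.choose_spec.1.mem_edges
    · exact h₂.choose_spec

theorem Play.pre_eq_append (π : G.Play) (i : ℕ) :
    π.pre i = (List.range i).map π.state ++ [π.state i] := by
  simp [Play.pre, List.range_succ]

theorem chooseStrategy_spec {k : VertexKind} (hk : k ≠ .switch) {P : G.State → G.State → Prop}
    {π : G.Play} (hπ : π.Consistent (G.chooseStrategy k P)) {i : ℕ} (hi : (i : ℕ∞) < π.len)
    (hki : G.kind (π.state i).1 = k) (h : ∃ q', G.Step (π.state i) q' ∧ P (π.state i) q') :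
    P (π.state i) (π.state (i + 1)) := by
  have h₁ := hπ i hi hki
  simp only [chooseStrategy, Play.pre_eq_append, List.getLast?_append, List.getLast?_singleton,
    Option.some_or, dif_pos h] at h₁
  have hs : G.kind (π.state i).1 ≠ .switch := hki ▸ hk
  have h₂ := (step_iff_of_ne_switch hs).1 (π.step i hi).2
  have h₃ := (step_iff_of_ne_switch hs).1 h.choose_spec.1
  have h₄ : π.state (i + 1) = h.choose := Prod.ext h₁ (h₂.2.trans h₃.2.symm)
  exact h₄ ▸ h.choose_spec.2

/-- The chosen successor has every rank `k` for which the current state has rank `k + 1`, so any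
rank known along the play decreases with each move. Rank `0` is impossible, hence the play stops,
and it cannot get stuck away from the target. -/
theorem Attr.reachPlayerWins {k : ℕ} (h : G.Attr k G.init) : G.ReachPlayerWins := by
  refine ⟨G.chooseStrategy .reach fun q q' => ∀ k, G.Attr (k + 1) q → G.Attr k q',
    fun π hπ => ?_⟩
  have key : ∀ k i : ℕ, (i : ℕ∞) ≤ π.len → G.Attr k (π.state i) → π.ReachWins := by
    intro k
    induction k with
    | zero => exact fun i _ h => h.elim
    | succ k ih =>
      intro i hi h
      rcases hi.eq_or_lt with hi | hi
      · refine ⟨i, hi.symm, (π.ends i hi.symm).elim (fun ht => ht) fun h' => ?_⟩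
        by_contra ht
        obtain ⟨q', hq'⟩ := h.exists_step ht
        exact h' hq'.hasOut
      · obtain ⟨ht, hst⟩ := π.step i hi
        refine ih (i + 1) (by exact_mod_cast Order.add_one_le_of_lt hi) ?_
        by_cases hk : G.kind (π.state i).1 = .reach
        · refine chooseStrategy_spec (by decide) hπ hi hk ?_ k h
          classical
          -- The successor belonging to the least rank serves all larger ranks by monotonicity.
          have hex : ∃ k, G.Attr (k + 1) (π.state i) := ⟨k, h⟩
          rcases Nat.find_spec hex with h | ⟨_, q', h₁, h₂⟩ | ⟨h, _⟩
          · exact absurd h ht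
          · exact ⟨q', h₁, fun l hl => h₂.mono (Nat.find_min' hex hl)⟩
          · exact absurd hk h
        · rcases h with h | ⟨h, _⟩ | ⟨_, _, h⟩
          · exact absurd h ht
          · exact absurd h hk
          · exact h _ hst
  exact key k 0 (by simp) (by rwa [π.start])

/-- The states without a rank form a trap: at reachability and switching vertices a ranked successor
would rank the state itself, and at a safety vertex some successor is unranked. The target has rank
`1`, so it is avoided. -/
theorem safetyPlayerWins_of_not_attr (h : ∀ k, ¬ G.Attr k G.init) : G.SafetyPlayerWins := by
  refine ⟨G.chooseStrategy .safety fun _ q' => ∀ k, ¬ G.Attr k q', fun π hπ => ?_⟩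
  have key : ∀ i : ℕ, (i : ℕ∞) ≤ π.len → ∀ k, ¬ G.Attr k (π.state i) := by
    intro i
    induction i with
    | zero => exact fun _ => by rwa [π.start]
    | succ i ih =>
      intro hi
      have hi : (i : ℕ∞) < π.len := lt_of_lt_of_le (by exact_mod_cast Nat.lt_succ_self i) hi
      have ih := ih hi.le
      obtain ⟨ht, hst⟩ := π.step i hi
      cases hk : G.kind (π.state i).1 with
      | reach => exact fun k h => ih (k + 1) (.inr (.inl ⟨hk, _, hst, h⟩))
      | switch =>
        exact fun k h => ih (k + 1) (.inr (.inr ⟨by simp [hk], ⟨_, hst⟩, fun q' hq' =>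
          hst.unique hk hq' ▸ h⟩))
      | safety =>
        refine chooseStrategy_spec (by decide) hπ hi hk ?_
        by_contra! hne
        choose! r hr using hne
        -- If all successors of a safety state had ranks, their maximum would rank the state. It
        -- exists because the edge set is finite and such a move keeps the counts, so a successor is
        -- determined by its vertex.
        let S : Finset ℕ := G.E.image fun e => r (e.2, (π.state i).2)
        refine ih (S.sup id + 1) (.inr (.inr ⟨by simp [hk], ⟨_, hst⟩, fun q' hq' =>
          (hr q' hq').mono (Finset.le_sup (f := id) (Finset.mem_image.2 ⟨_, hq'.mem_edges, ?_⟩))⟩))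
        rw [← ((step_iff_of_ne_switch (by simp [hk])).1 hq').2]
  rintro ⟨n, hn, hw⟩
  exact key n hn.ge 1 (.inl hw)

/-! ### Playing two strategies against each other -/

/-- All counts are valid positions. -/
def Good (q : G.State) : Prop := ∀ v : G.Swi, G.HasOut v.1 → q.2 v < (G.ord v).length

omit [DecidableEq V] in
theorem good_init : Good G.init := by
  rintro v ⟨u, hu⟩
  exact List.length_pos_of_mem ((G.mem_ord v u).2 hu)

theorem Good.step {q q' : G.State} (hq : Good q) (h : G.Step q q') : Good q' := by
  intro v hv
  rcases h with ⟨_, _, h⟩ | ⟨hk, h₁, h₂⟩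
  · rw [h]
    exact hq v hv
  · rw [h₂, upd]
    split_ifs with hvw
    · obtain ⟨u, hu⟩ := hv
      exact Nat.mod_lt _ (List.length_pos_of_mem ((G.mem_ord v u).2 hu))
    · exact hq v hv

/-- Ensures that a play leaves every vertex with an outgoing edge: for arbitrary counts a switching
vertex could point beyond its list. -/
theorem Good.exists_step {q : G.State} (hq : Good q) (h : G.HasOut q.1) : ∃ q', G.Step q q' := by
  by_cases hk : G.kind q.1 = .switch
  · have := hq ⟨q.1, hk⟩ h
    exact ⟨(_, _), .inr ⟨hk, List.getElem?_eq_getElem this, rfl⟩⟩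
  · obtain ⟨u, hu⟩ := h
    exact ⟨(u, q.2), .inl ⟨hk, hu, rfl⟩⟩

open Classical in
/-- The next state after a history, when both players follow their strategies. -/
noncomputable def next (σ : G.Strategy .reach) (τ : G.Strategy .safety) (h : List G.State)
    (q : G.State) : G.State :=
  match G.kind q.1 with
  | .reach => (σ.move h, q.2)
  | .safety => (τ.move h, q.2)
  | .switch => if h : ∃ q', G.Step q q' then h.choose else q

theorem step_next (σ : G.Strategy .reach) (τ : G.Strategy .safety) (h : List G.State)
    {q : G.State} (hq : Good q) (ho : G.HasOut q.1) : G.Step q (next σ τ (h ++ [q]) q) := by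
  unfold next
  split
  · next hk => exact .inl ⟨by simp [hk], σ.legal h q hk ho, rfl⟩
  · next hk => exact .inl ⟨by simp [hk], τ.legal h q hk ho, rfl⟩
  · next hk =>
    rw [dif_pos (hq.exists_step ho)]
    exact (hq.exists_step ho).choose_spec

/-- The history before time `n` and the state at time `n`. -/
noncomputable def run (σ : G.Strategy .reach) (τ : G.Strategy .safety) :
    ℕ → List G.State × G.State
  | 0 => ([], G.init)
  | n + 1 => ((run σ τ n).1 ++ [(run σ τ n).2],
      next σ τ ((run σ τ n).1 ++ [(run σ τ n).2]) (run σ τ n).2)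

theorem run_fst (σ : G.Strategy .reach) (τ : G.Strategy .safety) (n : ℕ) :
    (run σ τ n).1 = (List.range n).map fun i => (run σ τ i).2 := by
  induction n with
  | zero => rfl
  | succ n ih => rw [List.range_succ, List.map_append, ← ih]; rfl

/-- Both strategies together determine a run; cutting it at the first stopping time, if there is
one, yields a play. This is what prevents both players from winning. -/
theorem exists_consistent (σ : G.Strategy .reach) (τ : G.Strategy .safety) :
    ∃ π : G.Play, π.Consistent σ ∧ π.Consistent τ := by
  classical
  let s : ℕ → G.State := fun n => (run σ τ n).2
  let T : ℕ → Prop := fun n => (s n).1 = G.t ∨ ¬ G.HasOut (s n).1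
  have hstep : ∀ n, (∀ i ≤ n, ¬ T i) → Good (s n) → G.Step (s n) (s (n + 1)) := fun n hn hg =>
    step_next σ τ _ hg (not_not.1 (not_or.1 (hn n le_rfl)).2)
  have hgood : ∀ n, (∀ i < n, ¬ T i) → Good (s n) := by
    intro n
    induction n with
    | zero => exact fun _ => good_init
    | succ n ih =>
      intro h
      have hg := ih fun i hi => h i (by omega)
      exact hg.step (hstep n (fun i hi => h i (by omega)) hg)
  let len : ℕ∞ := if h : ∃ n, T n then (Nat.find h : ℕ∞) else ⊤
  have hlen : ∀ i : ℕ, (i : ℕ∞) < len → ∀ j ≤ i, ¬ T j := by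
    intro i hi j hj hT
    have h : ∃ n, T n := ⟨j, hT⟩
    simp only [len, dif_pos h, Nat.cast_lt] at hi
    exact Nat.find_min h (lt_of_le_of_lt hj hi) hT
  let π : G.Play :=
    { len := len
      state := s
      start := rfl
      step := fun i hi => ⟨(not_or.1 (hlen i hi i le_rfl)).1,
        hstep i (hlen i hi) (hgood i fun j hj => hlen i hi j hj.le)⟩
      ends := fun n hn => by
        by_cases h : ∃ n, T n
        · simp only [len, dif_pos h, Nat.cast_inj] at hn
          exact hn ▸ Nat.find_spec h
        · simp only [len, dif_neg h] at hn
          exact absurd hn (by simp) }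
  have hpre : ∀ i, π.pre i = (run σ τ i).1 ++ [(run σ τ i).2] := fun i => by
    rw [π.pre_eq_append, run_fst]
  have hnext : ∀ i, s (i + 1) = next σ τ (π.pre i) (s i) := fun i => by
    rw [hpre]
    rfl
  refine ⟨π, fun i _ hk => ?_, fun i _ hk => ?_⟩
  all_goals
    change (s (i + 1)).1 = _
    rw [hnext, next]
    change G.kind (s i).1 = _ at hk
    rw [hk]

theorem reachPlayerWins_iff : G.ReachPlayerWins ↔ ∃ k, G.Attr k G.init := by
  refine ⟨fun ⟨σ, hσ⟩ => ?_, fun ⟨k, h⟩ => h.reachPlayerWins⟩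
  by_contra! h
  obtain ⟨τ, hτ⟩ := safetyPlayerWins_of_not_attr h
  obtain ⟨π, h₁, h₂⟩ := exists_consistent σ τ
  exact hτ π h₂ (hσ π h₁)

theorem safetyPlayerWins_iff : G.SafetyPlayerWins ↔ ¬ ∃ k, G.Attr k G.init := by
  refine ⟨fun ⟨τ, hτ⟩ ⟨k, h⟩ => ?_, fun h => safetyPlayerWins_of_not_attr (not_exists.1 h)⟩
  obtain ⟨σ, hσ⟩ := h.reachPlayerWins
  obtain ⟨π, h₁, h₂⟩ := exists_consistent σ τ
  exact hτ π h₂ (hσ π h₁)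

end Determinacy

/-! ### The algorithm -/

/-- A game as data for the algorithm: the source, the target, and for each vertex the number of its
kind and its list of out-neighbours. -/
abbrev RawGame : Type := (ℕ × ℕ) × List (ℕ × List ℕ)

namespace RawGame

/-- Write each number in unary, followed by a zero. -/
def joinNumbers (l : List ℕ) : List Bool := l.flatMap fun m => List.replicate m true ++ [false]

/-- Read numbers in unary, each followed by a zero. -/
def splitNumbers (w : List Bool) : List ℕ :=
  (w.foldl (fun (p : ℕ × List ℕ) b => if b then (p.1 + 1, p.2) else (0, p.2 ++ [p.1])) (0, [])).2

/-- The list of numbers of a game. -/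
def toNumbers (r : RawGame) : List ℕ :=
  r.2.length :: r.1.1 :: r.1.2 :: r.2.flatMap fun q => q.1 :: q.2.length :: q.2

/-- Read the kind and the out-neighbours of one vertex. -/
def readVertex (p : List ℕ × List (ℕ × List ℕ)) : List ℕ × List (ℕ × List ℕ) :=
  ((p.1.tail.tail).drop (p.1.tail.headD 0),
    p.2 ++ [(p.1.headD 0, (p.1.tail.tail).take (p.1.tail.headD 0))])

/-- Read the vertices of a game. -/
def readVertices (n : ℕ) (l : List ℕ) : List (ℕ × List ℕ) :=
  ((List.replicate n ()).foldl (fun p _ => readVertex p) (l, [])).2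

/-- Read a game from a list of numbers. -/
def ofNumbers (l : List ℕ) : RawGame :=
  ((l.tail.headD 0, l.tail.tail.headD 0), readVertices (l.headD 0) l.tail.tail.tail)

/-- A list of out-neighbours is valid for a kind of vertex. -/
def validOut (n : ℕ) (q : ℕ × List ℕ) : Bool :=
  if decide (q.1 = 2) then
    (q.2.all fun u => decide (u ∈ List.range n)) &&
      (List.range n).all fun u => decide ((q.2.filter fun v => decide (v = u)).length ∈ List.range 2)
  else decide (q.2 = (List.range n).filter fun u => decide (u ∈ q.2))

/-- The data come from a game. -/
def valid (r : RawGame) : Bool :=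
  decide (r.1.1 ∈ List.range r.2.length) && decide (r.1.2 ∈ List.range r.2.length) &&
    r.2.all fun q => decide (q.1 ∈ List.range 3) && validOut r.2.length q

/-- All lists whose entries are bounded by the entries of the given list. -/
def allVectors (l : List ℕ) : List (List ℕ) :=
  l.foldl (fun acc d => acc.flatMap fun c => (List.range d).map fun i => c ++ [i]) [[]]

/-- The strict bounds for the counts. -/
def bounds (r : RawGame) : List ℕ := r.2.map fun q => q.2.length + 1

/-- The data of a vertex. -/
def vertex (r : RawGame) (v : ℕ) : ℕ × List ℕ := (r.2.drop v).headD (0, [])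

/-- Replace an entry of a list. -/
def setAt (c : List ℕ) (v x : ℕ) : List ℕ := c.take v ++ x :: c.drop (v + 1)

/-- The count at a vertex. -/
def count (q : ℕ × List ℕ) : ℕ := (q.2.drop q.1).headD 0

/-- The next count. -/
def nextCount (r : RawGame) (q : ℕ × List ℕ) : ℕ :=
  if decide (count q + 1 = (vertex r q.1).2.length) then 0 else count q + 1

/-- The reachability player can enforce that the next state is in `W`, or has reached the target. -/
def forces (r : RawGame) (W : List (ℕ × List ℕ)) (q : ℕ × List ℕ) : Bool :=
  decide (q.1 = r.1.2) ||
    if decide ((vertex r q.1).1 = 0) then (vertex r q.1).2.any fun u => decide ((u, q.2) ∈ W)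
    else if decide ((vertex r q.1).1 = 1) then
      !(vertex r q.1).2.isEmpty && (vertex r q.1).2.all fun u => decide ((u, q.2) ∈ W)
    else (((vertex r q.1).2.drop (count q)).take 1).any fun u =>
      decide ((u, setAt q.2 q.1 (nextCount r q)) ∈ W)

/-- All states with the given counts. -/
def states (r : RawGame) (C : List (List ℕ)) : List (ℕ × List ℕ) :=
  (List.range r.2.length).flatMap fun v => C.map fun c => (v, c)

/-- The states from which the reachability player wins. -/
def winning (r : RawGame) (C : List (List ℕ)) : List (ℕ × List ℕ) :=
  (states r C).foldl (fun W _ => (states r C).filter fun q => forces r W q) []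

/-- The reachability player wins the game. -/
def reachWins (r : RawGame) (C : List (List ℕ)) : Bool :=
  decide ((r.1.1, List.replicate r.2.length 0) ∈ winning r C)

/-! ### Running time of the algorithm -/

open StackProgram

variable {α : Type} [Enc α]

@[fun_prop]
theorem polyTime_joinNumbers {l : α → List ℕ} (hl : PolyTime l) :
    PolyTime fun x => joinNumbers (l x) := by
  unfold joinNumbers
  fun_prop

@[fun_prop]
theorem polyTime_splitNumbers {w : α → List Bool} (hw : PolyTime w) :
    PolyTime fun x => splitNumbers (w x) := by
  unfold splitNumbers
  refine PolyTime.snd.comp (hw.foldl_of_increment (c := fun _ => 10) (b := fun _ => (0, []))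
    (f := fun _ p b =>
    if b then (p.1 + 1, p.2) else (0, p.2 ++ [p.1])) (.const _) (by fun_prop) (.const 10)
    fun x p b => ?_)
  rcases p with ⟨m, l⟩
  have := size_append l [m]
  cases b
  · simp at this ⊢
    omega
  · simp
    omega

@[fun_prop]
theorem polyTime_toNumbers {r : α → RawGame} (hr : PolyTime r) :
    PolyTime fun x => toNumbers (r x) := by
  unfold toNumbers
  fun_prop

@[fun_prop]
theorem polyTime_readVertex {p : α → List ℕ × List (ℕ × List ℕ)} (hp : PolyTime p) :
    PolyTime fun x => readVertex (p x) := by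
  unfold readVertex
  fun_prop

theorem size_headD_add_size_tail_le (l : List ℕ) : size (l.headD 0) + size l.tail ≤ size l + 1 := by
  cases l with
  | nil => simp
  | cons a l => simp; omega

/-- Reading only moves numbers from the input to the output or discards them, so the total size
grows by at most a constant, even when default values replace missing numbers. -/
theorem size_readVertex_le (p : List ℕ × List (ℕ × List ℕ)) : size (readVertex p) ≤ size p + 10 := by
  rcases p with ⟨l, l'⟩
  have h₁ := size_headD_add_size_tail_le l
  have h₂ := size_headD_add_size_tail_le l.tail
  have h₃ := size_append (l.tail.tail.take (l.tail.headD 0)) (l.tail.tail.drop (l.tail.headD 0))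
  have h₄ := size_append l' [(l.headD 0, l.tail.tail.take (l.tail.headD 0))]
  rw [List.take_append_drop] at h₃
  simp only [readVertex, size_pair, size_cons, size_nil] at h₄ ⊢
  omega

@[fun_prop]
theorem polyTime_readVertices {n : α → ℕ} {l : α → List ℕ} (hn : PolyTime n) (hl : PolyTime l) :
    PolyTime fun x => readVertices (n x) (l x) :=
  PolyTime.snd.comp (hn.units.foldl_of_increment (c := fun _ => 10) (f := fun _ p _ => readVertex p)
    (hl.pair (.const [])) (by fun_prop) (.const 10) fun x p b => size_readVertex_le p)

@[fun_prop]
theorem polyTime_ofNumbers {l : α → List ℕ} (hl : PolyTime l) :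
    PolyTime fun x => ofNumbers (l x) := by
  unfold ofNumbers
  fun_prop

@[fun_prop]
theorem polyTime_validOut {n : α → ℕ} {q : α → ℕ × List ℕ} (hn : PolyTime n) (hq : PolyTime q) :
    PolyTime fun x => validOut (n x) (q x) := by
  unfold validOut
  fun_prop

@[fun_prop]
theorem polyTime_valid {r : α → RawGame} (hr : PolyTime r) : PolyTime fun x => valid (r x) := by
  unfold valid
  fun_prop

@[fun_prop]
theorem polyTime_bounds {r : α → RawGame} (hr : PolyTime r) : PolyTime fun x => bounds (r x) := by
  unfold bounds
  fun_prop

@[fun_prop]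
theorem polyTime_vertex {r : α → RawGame} {v : α → ℕ} (hr : PolyTime r) (hv : PolyTime v) :
    PolyTime fun x => vertex (r x) (v x) := by
  unfold vertex
  fun_prop

@[fun_prop]
theorem polyTime_setAt {c : α → List ℕ} {v y : α → ℕ} (hc : PolyTime c) (hv : PolyTime v)
    (hy : PolyTime y) : PolyTime fun x => setAt (c x) (v x) (y x) := by
  unfold setAt
  fun_prop

@[fun_prop]
theorem polyTime_count {q : α → ℕ × List ℕ} (hq : PolyTime q) : PolyTime fun x => count (q x) := by
  unfold count
  fun_prop

@[fun_prop]
theorem polyTime_nextCount {r : α → RawGame} {q : α → ℕ × List ℕ} (hr : PolyTime r)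
    (hq : PolyTime q) : PolyTime fun x => nextCount (r x) (q x) := by
  unfold nextCount
  fun_prop

@[fun_prop]
theorem polyTime_forces {r : α → RawGame} {W : α → List (ℕ × List ℕ)} {q : α → ℕ × List ℕ}
    (hr : PolyTime r) (hW : PolyTime W) (hq : PolyTime q) :
    PolyTime fun x => forces (r x) (W x) (q x) := by
  unfold forces
  fun_prop

@[fun_prop]
theorem polyTime_states {r : α → RawGame} {C : α → List (List ℕ)} (hr : PolyTime r)
    (hC : PolyTime C) : PolyTime fun x => states (r x) (C x) := by
  unfold states
  fun_prop

@[fun_prop]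
theorem polyTime_winning {r : α → RawGame} {C : α → List (List ℕ)} (hr : PolyTime r)
    (hC : PolyTime C) : PolyTime fun x => winning (r x) (C x) := by
  have hs := polyTime_states hr hC
  -- Every round filters the same list of states, so no accumulator outgrows that list.
  refine hs.foldl (b := fun _ => []) (f := fun x W _ => (states (r x) (C x)).filter fun q =>
    forces (r x) W q) (.const _) (by fun_prop) hs.size fun x l _ => ?_
  induction l using List.reverseRecOn with
  | nil => exact one_le_size _
  | append_singleton l a _ =>
    rw [List.foldl_append]
    exact size_sublist List.filter_sublist

@[fun_prop]
theorem polyTime_reachWins {r : α → RawGame} {C : α → List (List ℕ)} (hr : PolyTime r)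
    (hC : PolyTime C) : PolyTime fun x => reachWins (r x) (C x) := by
  unfold reachWins
  fun_prop

/-! ### The exponential enumeration of count vectors -/

theorem size_flatMap_le {β γ : Type} [Enc β] [Enc γ] (f : β → List γ) (k : ℕ) (l : List β)
    (h : ∀ b ∈ l, size (f b) ≤ k * size b) : size (l.flatMap f) ≤ k * size l + 1 := by
  induction l with
  | nil => simp
  | cons b l ih =>
    have h₁ := ih fun b hb => h b (List.mem_cons_of_mem _ hb)
    have h₂ := h b List.mem_cons_self
    have h₃ := size_append (f b) (l.flatMap f)
    rw [List.flatMap_cons, size_cons, mul_add, mul_add]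
    omega

/-- Appending a coordinate below `d` multiplies the total size by at most `2 ^ size d`. These
factors multiply up to `2` to the size of the list of bounds, since sizes add along a list. -/
theorem size_allVectors_le (l : List ℕ) : size (allVectors l) ≤ 2 ^ (size l + 2) := by
  have hmap : ∀ (c : List ℕ) (d n : ℕ), n ≤ d →
      size ((List.range n).map fun i => c ++ [i]) ≤ 1 + n * (size c + 2 * d + 2) := by
    intro c d n hn
    induction n with
    | zero => simp
    | succ n ih =>
      have h₁ := ih (by omega)
      have h₂ := size_append ((List.range n).map fun i => c ++ [i]) [c ++ [n]]
      have h₃ := size_append c [n]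
      rw [List.range_succ, List.map_append, List.map_singleton, add_one_mul]
      simp only [size_cons, size_nil, size_nat] at h₂ h₃
      omega
  have hstep : ∀ (acc : List (List ℕ)) (d : ℕ), size (acc.flatMap fun c =>
      (List.range d).map fun i => c ++ [i]) ≤ 2 ^ size d * size acc := by
    intro acc d
    have h₁ := size_flatMap_le (fun c : List ℕ => (List.range d).map fun i => c ++ [i])
      (1 + 3 * d + 2 * d * d) acc fun c _ => by
        refine (hmap c d d le_rfl).trans ?_
        have := one_le_size c
        nlinarith [Nat.mul_le_mul_left (d * d) this, Nat.mul_le_mul_left d this]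
    -- The left side is at most `2 * (d + 1) ^ 2`, and `size d` is `2 * d + 1`.
    have h₂ : (2 + 3 * d + 2 * d * d) ≤ 2 ^ size d := by
      have h₃ : d + 1 ≤ 2 ^ d := Nat.lt_two_pow_self
      have h₄ := Nat.mul_le_mul h₃ h₃
      rw [size_nat, pow_succ, two_mul, pow_add]
      nlinarith
    have h₃ := Nat.mul_le_mul_right (size acc) h₂
    have := one_le_size acc
    refine h₁.trans (le_trans ?_ h₃)
    nlinarith
  have key : ∀ (l : List ℕ) (acc : List (List ℕ)), size (l.foldl (fun acc d => acc.flatMap fun c =>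
      (List.range d).map fun i => c ++ [i]) acc) ≤ 2 ^ size l * size acc := by
    intro l
    induction l with
    | nil => intro acc; simp; omega
    | cons d l ih =>
      intro acc
      refine (ih _).trans ((Nat.mul_le_mul_left _ (hstep acc d)).trans ?_)
      rw [← mul_assoc, ← pow_add]
      exact Nat.mul_le_mul_right _ (Nat.pow_le_pow_right two_pos (by rw [size_cons]; omega))
  refine (key l [[]]).trans ?_
  rw [pow_add]
  exact Nat.mul_le_mul_left _ (by decide)

theorem expTime_allVectors {l : α → List ℕ} (hl : PolyTime l) :
    ExpTime fun x => allVectors (l x) := by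
  refine ExpTime.foldl (b := fun _ => [[]]) (f := fun _ acc d => acc.flatMap fun c =>
    (List.range d).map fun i => c ++ [i]) hl (.const _) (by fun_prop)
    (B := fun x => 2 ^ (size (l x) + 2))
    (.two_pow (hl.size.add (.const 2))) fun x l₁ hl₁ => ?_
  refine (size_allVectors_le l₁).trans (Nat.pow_le_pow_right two_pos ?_)
  have := size_prefix hl₁
  omega

/-- The game with the given word, if it is one. -/
def parse (w : List Bool) : RawGame := ofNumbers (splitNumbers w)

/-- The word is the word of a game. -/
def isGame (w : List Bool) : Bool :=
  valid (parse w) && decide (joinNumbers (toNumbers (parse w)) = w)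

theorem polyTime_parse : PolyTime parse := by
  unfold parse
  fun_prop

theorem polyTime_isGame : PolyTime isGame := by
  have := polyTime_parse
  unfold isGame
  fun_prop

/-- The word is the word of a game that is won by the player. -/
def decideWinner (reach : Bool) (w : List Bool) : Bool :=
  isGame w && decide (reachWins (parse w) (allVectors (bounds (parse w))) = reach)

theorem expTime_decideWinner (reach : Bool) : ExpTime (decideWinner reach) := by
  have h₁ := polyTime_parse
  have h₂ := polyTime_isGame
  have h₃ : PolyTime fun p : List Bool × List (List ℕ) =>
      isGame p.1 && decide (reachWins (parse p.1) p.2 = reach) := by fun_prop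
  have h₄ : ExpTime fun w => (w, allVectors (bounds (parse w))) :=
    .pair (.of_polyTime .id) (expTime_allVectors (by fun_prop))
  have h := ExpTime.polyTime_comp h₃ h₄
  exact h

/-! ### Correctness of the algorithm -/

theorem splitNumbers_joinNumbers (l : List ℕ) : splitNumbers (joinNumbers l) = l := by
  have h₁ : ∀ (m a : ℕ) (r : List ℕ), (List.replicate m true).foldl
      (fun (p : ℕ × List ℕ) b => if b then (p.1 + 1, p.2) else (0, p.2 ++ [p.1])) (a, r) =
        (a + m, r) := by
    intro m
    induction m with
    | zero => simp
    | succ m ih =>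
      intro a r
      rw [List.replicate_succ, List.foldl_cons, if_pos rfl, ih]
      simp
      omega
  have h₂ : ∀ (l r : List ℕ), (joinNumbers l).foldl
      (fun (p : ℕ × List ℕ) b => if b then (p.1 + 1, p.2) else (0, p.2 ++ [p.1])) (0, r) =
        (0, r ++ l) := by
    intro l
    induction l with
    | nil => simp [joinNumbers]
    | cons m l ih =>
      intro r
      have : joinNumbers (m :: l) = List.replicate m true ++ (false :: joinNumbers l) := by
        simp [joinNumbers]
      rw [this, List.foldl_append, h₁, List.foldl_cons, if_neg (by simp), ih]
      simp
  rw [splitNumbers, h₂, List.nil_append]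

theorem ofNumbers_toNumbers (r : RawGame) : ofNumbers (toNumbers r) = r := by
  obtain ⟨⟨s, t⟩, R⟩ := r
  have key : ∀ (R R' : List (ℕ × List ℕ)), (List.replicate R.length ()).foldl
      (fun p _ => readVertex p) (R.flatMap fun q => q.1 :: q.2.length :: q.2, R') =
        ([], R' ++ R) := by
    intro R
    induction R with
    | nil => simp
    | cons q R ih =>
      intro R'
      have h : readVertex ((q :: R).flatMap fun q => q.1 :: q.2.length :: q.2, R') =
          (R.flatMap fun q => q.1 :: q.2.length :: q.2, R' ++ [q]) := by
        simp [readVertex]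
      rw [List.length_cons, List.replicate_succ, List.foldl_cons, h, ih]
      simp
  simp [ofNumbers, toNumbers, readVertices, key]

/-- The data of a game. -/
def ofGame {n : ℕ} (G : SwitchingGame (Fin n)) : RawGame :=
  ((G.s, G.t), (List.finRange n).map fun v => (kindCode (G.kind v), (G.outList v).map Fin.val))

variable {n : ℕ} {G : SwitchingGame (Fin n)}

@[simp] theorem length_ofGame : (ofGame G).2.length = n := by simp [ofGame]

theorem joinNumbers_ofGame : joinNumbers (toNumbers (ofGame G)) = G.encode := by
  have : toNumbers (ofGame G) = G.numbers := by
    simp [toNumbers, ofGame, numbers, List.flatMap_map]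
  rw [this]
  rfl

theorem parse_encode : parse G.encode = ofGame G := by
  rw [← joinNumbers_ofGame, parse, splitNumbers_joinNumbers, ofNumbers_toNumbers]

theorem mem_outList {v u : Fin n} : u ∈ G.outList v ↔ (v, u) ∈ G.E := by
  unfold outList
  split_ifs with h
  · exact G.mem_ord ⟨v, h⟩ u
  · simp

theorem validOut_switch {l : List ℕ} : validOut n (2, l) = true ↔ (∀ u ∈ l, u < n) ∧ l.Nodup := by
  simp only [validOut, decide_true, if_true, Bool.and_eq_true, List.all_eq_true, List.mem_range,
    decide_eq_true_eq]
  refine and_congr_right fun h => ?_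
  rw [List.nodup_iff_count_le_one]
  have hc : ∀ u, (l.filter fun v => decide (v = u)).length = l.count u := fun u => by
    rw [List.count, List.countP_eq_length_filter]
    rfl
  simp only [hc]
  refine ⟨fun h' u => ?_, fun h' u _ => Nat.lt_succ_of_le (h' u)⟩
  -- The check counts only numbers below `n`; others do not occur in the list at all.
  by_cases hu : u ∈ l
  · exact Nat.le_of_lt_succ (h' u (h u hu))
  · rw [List.count_eq_zero_of_not_mem hu]
    omega

theorem validOut_of_ne {k : ℕ} (hk : k ≠ 2) {l : List ℕ} :
    validOut n (k, l) = true ↔ l = (List.range n).filter fun u => decide (u ∈ l) := by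
  simp [validOut, hk]

theorem valid_iff {r : RawGame} : valid r = true ↔ r.1.1 < r.2.length ∧ r.1.2 < r.2.length ∧
    ∀ q ∈ r.2, q.1 < 3 ∧ validOut r.2.length q = true := by
  simp [valid, and_assoc]

theorem valid_ofGame : valid (ofGame G) = true := by
  rw [valid_iff, length_ofGame]
  refine ⟨G.s.2, G.t.2, fun q hq => ?_⟩
  simp only [ofGame, List.mem_map, List.mem_finRange, true_and] at hq
  obtain ⟨v, rfl⟩ := hq
  refine ⟨by cases G.kind v <;> simp [kindCode], ?_⟩
  by_cases h : G.kind v = .switch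
  · rw [h, kindCode, validOut_switch, outList, dif_pos h]
    refine ⟨by simp, (G.ord_nodup _).map Fin.val_injective⟩
  · rw [validOut_of_ne (by cases hk : G.kind v <;> simp_all [kindCode]),
      ← List.map_coe_finRange_eq_range,
      List.filter_map]
    congr 1
    have hmem : ∀ u : Fin n, (u : ℕ) ∈ (G.outList v).map Fin.val ↔ u ∈ G.outList v := fun u =>
      List.mem_map_of_injective Fin.val_injective
    simp only [Function.comp_def, hmem, mem_outList]
    simp [outList, h]

/-- The kind with the given number. -/
def kindOfCode : ℕ → VertexKind
  | 0 => .reach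
  | 1 => .safety
  | _ => .switch

/-- The lists become the out-neighbours. Outside switching vertices validity forces the list to be
increasing, as in `outList`; otherwise the data of the game built here could differ from `r`. -/
theorem exists_game_of_valid {r : RawGame} (hr : valid r = true) :
    ∃ (n : ℕ) (G : SwitchingGame (Fin n)), ofGame G = r := by
  obtain ⟨hs, ht, hv⟩ := valid_iff.1 hr
  have hk : ∀ v, (r.2.get v).1 < 3 := fun v => (hv _ (List.get_mem _ _)).1
  have hv : ∀ v, validOut r.2.length (r.2.get v) = true := fun v => (hv _ (List.get_mem _ _)).2
  have hlt : ∀ v, ∀ u ∈ (r.2.get v).2, u < r.2.length := by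
    intro v u hu
    by_cases h : (r.2.get v).1 = 2
    · have := hv v
      rw [← Prod.mk.eta (p := r.2.get v), h, validOut_switch] at this
      exact this.1 u hu
    · have := hv v
      rw [← Prod.mk.eta (p := r.2.get v), validOut_of_ne h] at this
      rw [this] at hu
      simpa using (List.mem_filter.1 hu).1
  have hsw : ∀ v, kindOfCode (r.2.get v).1 = .switch → (r.2.get v).1 = 2 := by
    intro v h
    have := hk v
    generalize (r.2.get v).1 = k at *
    interval_cases k <;> simp_all [kindOfCode]
  have hcode : ∀ v, kindCode (kindOfCode (r.2.get v).1) = (r.2.get v).1 := by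
    intro v
    have := hk v
    generalize (r.2.get v).1 = k at *
    interval_cases k <;> rfl
  let G : SwitchingGame (Fin r.2.length) :=
    { E := Finset.univ.filter fun e => (e.2 : ℕ) ∈ (r.2.get e.1).2
      kind := fun v => kindOfCode (r.2.get v).1
      ord := fun v => (r.2.get v.1).2.pmap Fin.mk (hlt v.1)
      ord_nodup := fun v => by
        have := hv v.1
        rw [← Prod.mk.eta (p := r.2.get v.1), hsw _ v.2, validOut_switch] at this
        exact this.2.pmap fun a _ b _ h => congrArg Fin.val h
      mem_ord := fun v u => by
        simp only [List.mem_pmap, Finset.mem_filter, Finset.mem_univ, true_and]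
        exact ⟨fun ⟨a, ha, h⟩ => h ▸ ha, fun h => ⟨u, h, rfl⟩⟩
      s := ⟨_, hs⟩
      t := ⟨_, ht⟩ }
  refine ⟨_, G, Prod.ext rfl (List.ext_getElem (by simp) fun i h₁ h₂ => ?_)⟩
  have hget : r.2[i] = r.2.get ⟨i, h₂⟩ := rfl
  simp only [ofGame, List.getElem_map, List.getElem_finRange, hget]
  refine Prod.ext (hcode _) ?_
  simp only [outList, G]
  split_ifs with h
  · simp [List.map_pmap]
  · have h₃ : (r.2.get ⟨i, h₂⟩).1 ≠ 2 := fun h' => h (by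
      change kindOfCode (r.2.get ⟨i, h₂⟩).1 = _
      rw [h']
      rfl)
    have := hv ⟨i, h₂⟩
    rw [← Prod.mk.eta (p := r.2.get ⟨i, h₂⟩), validOut_of_ne h₃,
      ← List.map_coe_finRange_eq_range, List.filter_map] at this
    simp only [Function.comp_def] at this
    rw [this]
    simp

theorem mem_allVectors {l c : List ℕ} : c ∈ allVectors l ↔ List.Forall₂ (· < ·) c l := by
  have key : ∀ (l : List ℕ) (acc : List (List ℕ)), c ∈ l.foldl (fun acc d => acc.flatMap fun c =>
      (List.range d).map fun i => c ++ [i]) acc ↔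
        ∃ c₁ ∈ acc, ∃ c₂, List.Forall₂ (· < ·) c₂ l ∧ c = c₁ ++ c₂ := by
    intro l
    induction l with
    | nil => simp
    | cons d l ih =>
      intro acc
      rw [List.foldl_cons, ih]
      simp only [List.mem_flatMap, List.mem_map, List.mem_range, List.forall₂_cons_right_iff]
      constructor
      · rintro ⟨_, ⟨c₁, h₁, i, hi, rfl⟩, c₂, h₂, rfl⟩
        exact ⟨c₁, h₁, i :: c₂, ⟨i, c₂, hi, h₂, rfl⟩, by simp⟩
      · rintro ⟨c₁, h₁, _, ⟨i, c₂, hi, h₂, rfl⟩, rfl⟩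
        exact ⟨c₁ ++ [i], ⟨c₁, h₁, i, hi, rfl⟩, c₂, h₂, by simp⟩
  rw [allVectors, key]
  simp

/-! ### Stabilisation and comparison with the attractor -/

/-- Iterated filtering by a monotone condition is stationary after as many steps as the list is
long. -/
theorem mem_iterate_filter_length {α : Type} (L : List α) (p : List α → α → Bool)
    (hp : ∀ W W' : List α, W ⊆ W' → ∀ q, p W q = true → p W' q = true) (k : ℕ) {q : α}
    (hq : q ∈ (fun W => L.filter (p W))^[k] []) : q ∈ (fun W => L.filter (p W))^[L.length] [] := by
  set F : List α → List α := fun W => L.filter (p W) with hF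
  have hsub : ∀ k, (F^[k] []).Sublist (F^[k + 1] []) := by
    intro k
    induction k with
    | zero => exact List.nil_sublist _
    | succ k ih =>
      rw [Function.iterate_succ_apply', Function.iterate_succ_apply' F (k + 1)]
      exact List.monotone_filter_right L fun a => hp _ _ ih.subset a
  -- Until the chain becomes stationary each round adds an element; at `k = L.length` the second
  -- alternative would exceed the length of `L`.
  have hlen : ∀ k, F^[k + 1] [] = F^[k] [] ∨ k + 1 ≤ (F^[k + 1] []).length := by
    intro k
    induction k with
    | zero =>
      rcases h : F^[1] [] with _ | ⟨a, l⟩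
      · exact .inl rfl
      · exact .inr (by simp)
    | succ k ih =>
      rcases ih with h | h
      · left
        rw [Function.iterate_succ_apply', h, ← Function.iterate_succ_apply' F, h]
      · rcases (hsub (k + 1)).length_le.eq_or_lt with h' | h'
        · exact .inl ((hsub (k + 1)).eq_of_length h').symm
        · exact .inr (by omega)
  have hfix : F (F^[L.length] []) = F^[L.length] [] := by
    rw [← Function.iterate_succ_apply' F]
    refine (hlen _).resolve_right fun h => ?_
    rw [Function.iterate_succ_apply'] at h
    have : (F (F^[L.length] [])).length ≤ L.length := List.length_filter_le _ _
    omega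
  have hmono : Monotone fun k => {q | q ∈ F^[k] []} := monotone_nat_of_le_succ fun k =>
    (hsub k).subset
  rcases le_total k L.length with h | h
  · exact hmono h hq
  · obtain ⟨m, rfl⟩ := Nat.exists_eq_add_of_le' h
    rwa [Function.iterate_add_apply, Function.iterate_fixed hfix] at hq

theorem forces_mono {r : RawGame} {W W' : List (ℕ × List ℕ)} (h : W ⊆ W') (q : ℕ × List ℕ)
    (hq : forces r W q = true) : forces r W' q = true := by
  simp only [forces, Bool.or_eq_true] at hq ⊢
  refine hq.imp_right fun hq => ?_
  split_ifs at hq ⊢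
  · simp only [List.any_eq_true, decide_eq_true_eq] at hq ⊢
    exact hq.imp fun u hu => ⟨hu.1, h hu.2⟩
  · simp only [Bool.and_eq_true, List.all_eq_true, decide_eq_true_eq] at hq ⊢
    exact ⟨hq.1, fun u hu => h (hq.2 u hu)⟩
  · simp only [List.any_eq_true, decide_eq_true_eq] at hq ⊢
    exact hq.imp fun u hu => ⟨hu.1, h hu.2⟩

variable {n : ℕ} {G : SwitchingGame (Fin n)}

theorem vertex_ofGame (v : Fin n) :
    vertex (ofGame G) v = (kindCode (G.kind v), (G.outList v).map Fin.val) := by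
  have h : (v : ℕ) < (ofGame G).2.length := by simp
  rw [vertex, List.drop_eq_getElem_cons h, List.headD_cons]
  simp [ofGame]

/-- The bound is weak because `bounds` adds one to each out-degree: a vertex without outgoing edges
still needs the count `0`. Vertices of the players carry a coordinate too, which no move reads or
changes. -/
theorem mem_allVectors_bounds {c : List ℕ} : c ∈ allVectors (bounds (ofGame G)) ↔
    c.length = n ∧ ∀ v : Fin n, c.getD v 0 ≤ (G.outList v).length := by
  rw [mem_allVectors, List.forall₂_iff_get]
  simp only [bounds, ofGame, List.length_map, List.length_finRange, List.get_eq_getElem,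
    List.getElem_map, List.getElem_finRange]
  refine and_congr_right fun hc => ⟨fun h v => ?_, fun h i h₁ h₂ => ?_⟩
  · have := h v (by omega) v.2
    rw [List.getD_eq_getElem _ _ (by omega)]
    exact Nat.le_of_lt_succ this
  · have := h ⟨i, h₂⟩
    rw [List.getD_eq_getElem _ _ h₁] at this
    exact Nat.lt_succ_of_le this

theorem setAt_eq_set {c : List ℕ} {v : ℕ} (hv : v < c.length) (x : ℕ) :
    setAt c v x = c.set v x := by
  rw [setAt, List.set_eq_take_append_cons_drop, if_pos hv]

theorem getD_setAt {c : List ℕ} {v : ℕ} (hv : v < c.length) (x i : ℕ) :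
    (setAt c v x).getD i 0 = if v = i then x else c.getD i 0 := by
  rw [setAt_eq_set hv, List.getD_eq_getElem?_getD, List.getElem?_set, if_pos hv]
  split_ifs <;> simp

/-- The state with the given vertex and counts. -/
def toState (G : SwitchingGame (Fin n)) (v : Fin n) (c : List ℕ) : G.State :=
  (v, fun u => c.getD u.1 0)

theorem count_eq (v : ℕ) (c : List ℕ) : count (v, c) = c.getD v 0 := by
  simp [count, List.getD_eq_getElem?_getD, List.headD_eq_head?_getD, List.head?_drop]

theorem step_toState_of_ne_switch {v : Fin n} {c : List ℕ} (h : G.kind v ≠ .switch) {q' : G.State} :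
    G.Step (toState G v c) q' ↔ ∃ u ∈ G.outList v, q' = toState G u c := by
  rw [step_iff_of_ne_switch (q := toState G v c) h]
  constructor
  · rintro ⟨h₁, h₂⟩
    exact ⟨q'.1, mem_outList.2 h₁, Prod.ext rfl h₂⟩
  · rintro ⟨u, hu, rfl⟩
    exact ⟨mem_outList.1 hu, rfl⟩

theorem setAt_mem_allVectors {v : Fin n} {c : List ℕ} (hc : c ∈ allVectors (bounds (ofGame G)))
    {x : ℕ} (hx : x ≤ (G.outList v).length) : setAt c v x ∈ allVectors (bounds (ofGame G)) := by
  rw [mem_allVectors_bounds] at hc ⊢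
  have hv : (v : ℕ) < c.length := hc.1 ▸ v.2
  refine ⟨by rw [setAt_eq_set hv, List.length_set, hc.1], fun u => ?_⟩
  rw [getD_setAt hv]
  split_ifs with h
  · rwa [← Fin.ext h]
  · exact hc.2 u

/-- A move exists only if the count is a valid position; then its successor is at most the length,
and resetting to `0` at the length agrees with reduction modulo it. -/
theorem step_toState_of_switch {v : Fin n} {c : List ℕ} (hk : G.kind v = .switch)
    (hc : c ∈ allVectors (bounds (ofGame G))) {q' : G.State} :
    G.Step (toState G v c) q' ↔ ∃ u, (G.outList v)[c.getD v 0]? = some u ∧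
      q' = toState G u (setAt c v (nextCount (ofGame G) (v, c))) := by
  have hv : (v : ℕ) < c.length := (mem_allVectors_bounds.1 hc).1 ▸ v.2
  have ho : G.outList v = G.ord ⟨v, hk⟩ := dif_pos hk
  have hupd : ∀ u, (G.outList v)[c.getD v 0]? = some u →
      G.upd (toState G v c).2 ⟨v, hk⟩ =
        (toState G u (setAt c v (nextCount (ofGame G) (v, c)))).2 := by
    intro u hu
    obtain ⟨hlt, -⟩ := List.getElem?_eq_some_iff.1 hu
    funext w
    simp only [upd, toState, getD_setAt hv, nextCount, vertex_ofGame, count_eq, List.length_map,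
      decide_eq_true_eq]
    by_cases hw : v = w.1
    · have hw' : (⟨v, hk⟩ : G.Swi) = w := Subtype.ext hw
      subst hw'
      rw [if_pos rfl, if_pos rfl, ← ho]
      split_ifs with h
      · rw [h, Nat.mod_self]
      · have h : ¬ c.getD (v : ℕ) 0 + 1 = (G.outList v).length := h
        exact Nat.mod_eq_of_lt (show c.getD (v : ℕ) 0 + 1 < (G.outList v).length by omega)
    · rw [if_neg fun h => hw (congrArg Subtype.val h), if_neg fun h => hw (Fin.ext h)]
  constructor
  · rintro (⟨h, -⟩ | ⟨_, h₁, h₂⟩)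
    · exact absurd hk h
    · have h₁ : (G.outList v)[c.getD v 0]? = some q'.1 := ho ▸ h₁
      exact ⟨q'.1, h₁, Prod.ext rfl (h₂.trans (hupd _ h₁))⟩
  · rintro ⟨u, h₁, rfl⟩
    refine .inr ⟨hk, ?_, (hupd u h₁).symm⟩
    rw [ho] at h₁
    exact h₁

theorem nextCount_le {v : Fin n} {c : List ℕ} {u : Fin n}
    (h : (G.outList v)[c.getD v 0]? = some u) :
    nextCount (ofGame G) (v, c) ≤ (G.outList v).length := by
  obtain ⟨hlt, -⟩ := List.getElem?_eq_some_iff.1 h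
  simp only [nextCount, count_eq, vertex_ofGame, List.length_map]
  split_ifs <;> omega

/-- One round of the algorithm is one unfolding of `Attr`. Agreement of `W` with `P` is needed only
on enumerated vectors, because moves from these lead to enumerated vectors again. -/
theorem forces_iff {v : Fin n} {c : List ℕ} (hc : c ∈ allVectors (bounds (ofGame G)))
    {W : List (ℕ × List ℕ)} {P : G.State → Prop} (hW : ∀ (u : Fin n) (c' : List ℕ),
      c' ∈ allVectors (bounds (ofGame G)) → (((u : ℕ), c') ∈ W ↔ P (toState G u c'))) :
    forces (ofGame G) W (v, c) = true ↔ v = G.t ∨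
      (G.kind v = .reach ∧ ∃ q', G.Step (toState G v c) q' ∧ P q') ∨
      (G.kind v ≠ .reach ∧ (∃ q', G.Step (toState G v c) q') ∧
        ∀ q', G.Step (toState G v c) q' → P q') := by
  have ht : ((v : ℕ) = (ofGame G).1.2) ↔ v = G.t := (Fin.ext_iff (b := G.t)).symm
  simp only [forces, Bool.or_eq_true, decide_eq_true_eq, vertex_ofGame, count_eq, ht]
  refine or_congr_right ?_
  cases hk : G.kind v with
  | reach =>
    have hs : G.kind v ≠ .switch := by simp [hk]
    simp only [kindCode, if_true, List.any_map, List.any_eq_true, Function.comp_apply,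
      decide_eq_true_eq, hW _ _ hc, step_toState_of_ne_switch hs, ne_eq, not_true_eq_false,
      false_and, true_and, or_false]
    exact ⟨fun ⟨u, hu, h⟩ => ⟨_, ⟨u, hu, rfl⟩, h⟩, fun ⟨_, ⟨u, hu, e⟩, h⟩ => ⟨u, hu, e ▸ h⟩⟩
  | safety =>
    have hs : G.kind v ≠ .switch := by simp [hk]
    have he : (!((G.outList v).map Fin.val).isEmpty) = true ↔ ∃ u, u ∈ G.outList v := by
      rw [← List.isEmpty_eq_false_iff_exists_mem]
      simp
    simp only [kindCode, one_ne_zero, if_true, if_false, Bool.and_eq_true, he, List.all_map,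
      List.all_eq_true, Function.comp_apply,
      decide_eq_true_eq, hW _ _ hc, step_toState_of_ne_switch hs, ne_eq, reduceCtorEq,
      not_false_eq_true, false_and, true_and, false_or]
    exact and_congr ⟨fun ⟨u, hu⟩ => ⟨_, u, hu, rfl⟩, fun ⟨_, u, hu, _⟩ => ⟨u, hu⟩⟩
      ⟨fun h _ ⟨u, hu, e⟩ => e ▸ h u hu, fun h u hu => h _ ⟨u, hu, rfl⟩⟩
  | switch =>
    -- At a switching vertex there is at most one successor, so the existential test by `any`
    -- expresses both the existence of a move and the condition on all moves.
    have hd : ((G.outList v).map Fin.val |>.drop (c.getD v 0)).take 1 =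
        ((G.outList v)[c.getD v 0]?.map Fin.val).toList := by
      rw [List.take_one, List.head?_drop, List.getElem?_map]
    simp only [hd, step_toState_of_switch hk hc, kindCode]
    cases hu : (G.outList v)[c.getD v 0]? with
    | none => simp
    | some u => simp [hW u _ (setAt_mem_allVectors hc (nextCount_le hu))]

theorem mem_states {v : Fin n} {c : List ℕ} {C : List (List ℕ)} :
    ((v : ℕ), c) ∈ states (ofGame G) C ↔ c ∈ C := by
  simp [states]

theorem mem_iterate_iff_attr (k : ℕ) : ∀ (v : Fin n) (c : List ℕ),
    c ∈ allVectors (bounds (ofGame G)) → (((v : ℕ), c) ∈ (fun W =>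
      (states (ofGame G) (allVectors (bounds (ofGame G)))).filter fun q =>
        forces (ofGame G) W q)^[k] [] ↔ G.Attr k (toState G v c)) := by
  induction k with
  | zero => exact fun v c _ => by simp [Attr]
  | succ k ih =>
    intro v c hc
    rw [Function.iterate_succ_apply', List.mem_filter, mem_states, forces_iff hc ih]
    exact and_iff_right hc

theorem reachWins_iff : reachWins (ofGame G) (allVectors (bounds (ofGame G))) = true ↔
    G.ReachPlayerWins := by
  have h₀ : List.replicate n 0 ∈ allVectors (bounds (ofGame G)) := by
    rw [mem_allVectors_bounds]
    simp
  have hi : G.init = toState G G.s (List.replicate n 0) := by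
    refine Prod.ext rfl (funext fun u => ?_)
    simp [init, toState]
  rw [reachPlayerWins_iff, hi, reachWins, decide_eq_true_eq, winning, List.foldl_const,
    length_ofGame]
  constructor
  · exact fun h => ⟨_, (mem_iterate_iff_attr _ _ _ h₀).1 h⟩
  · rintro ⟨k, h⟩
    exact mem_iterate_filter_length _ _ (fun W W' h q => forces_mono h q) k
      ((mem_iterate_iff_attr k _ _ h₀).2 h)

/-- The parser is total and fills in defaults, so malformed words may also give valid data; encoding
the result again and comparing rules them out. -/
theorem isGame_iff {w : List Bool} :
    isGame w = true ↔ ∃ (n : ℕ) (G : SwitchingGame (Fin n)), G.encode = w := by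
  simp only [isGame, Bool.and_eq_true, decide_eq_true_eq]
  constructor
  · rintro ⟨h₁, h₂⟩
    obtain ⟨n, G, h⟩ := exists_game_of_valid h₁
    exact ⟨n, G, by rw [← joinNumbers_ofGame, h, h₂]⟩
  · rintro ⟨n, G, rfl⟩
    rw [parse_encode, joinNumbers_ofGame]
    exact ⟨valid_ofGame, rfl⟩

theorem decideWinner_iff {b : Bool} {w : List Bool} {P : ∀ n, SwitchingGame (Fin n) → Prop}
    (hP : ∀ n (G : SwitchingGame (Fin n)),
      reachWins (ofGame G) (allVectors (bounds (ofGame G))) = b ↔ P n G) :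
    decideWinner b w = true ↔ ∃ (n : ℕ) (G : SwitchingGame (Fin n)), G.encode = w ∧ P n G := by
  rw [decideWinner, Bool.and_eq_true, decide_eq_true_eq, isGame_iff]
  constructor
  · rintro ⟨⟨n, G, rfl⟩, h⟩
    rw [parse_encode] at h
    exact ⟨n, G, rfl, (hP n G).1 h⟩
  · rintro ⟨n, G, rfl, h⟩
    rw [parse_encode]
    exact ⟨⟨n, G, rfl⟩, (hP n G).2 h⟩

end RawGame

end SwitchingGame

theorem mainTheorem4 :
    InEXPTIME SwitchingGame.reachLanguage ∧ InEXPTIME SwitchingGame.safetyLanguage := by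
  refine ⟨(SwitchingGame.RawGame.expTime_decideWinner true).inEXPTIME fun w =>
      SwitchingGame.RawGame.decideWinner_iff fun n G => SwitchingGame.RawGame.reachWins_iff,
    (SwitchingGame.RawGame.expTime_decideWinner false).inEXPTIME fun w =>
      SwitchingGame.RawGame.decideWinner_iff fun n G => ?_⟩
  -- By determinacy, the negative answer of the algorithm is exactly a win of the safety player.
  rw [← Bool.not_eq_true, SwitchingGame.RawGame.reachWins_iff, SwitchingGame.reachPlayerWins_iff,
    SwitchingGame.safetyPlayerWins_iff]
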